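/- **Setting.** Let $\rho_1,\dots,\rho_N:\mathbb R^n\to\mathbb R$ be convex, with all subgradients of $\rho_i$ bounded in norm by $B_i>0$ and $\rho_i(x)\ge\tau_i\|x\|_2$ for all $x$, where $\tau_i>0$. Let $\gamma_1,\dots,\gamma_N:\mathbb R^n\to\mathbb R$ be convex and differentiable, with $L_{\gamma_i}$-Lipschitz gradients, bounded below by $\underline\gamma_i$, and with $\|\nabla\gamma_i(x)\|_2\le G_i$ for all $x$. Let $A=[A_1,\dots,A_N]$ with $A_i\in\mathbb R^{m\times n}$ be surjective, $b\in\mathbb R^m$, and for $\mathbf x=(x_1,\dots,x_N)\in\mathbb R^{nN}$ put $\bar\rho(\mathbf x)=\sum_i\rho_i(x_i)$, $\bar\gamma(\mathbf x)=\sum_i\gamma_i(x_i)$, $\bar F=\bar\rho+\bar\gamma$, and $\bar F^*=\min\{\bar F(\mathbf x):A\mathbf x=b\}$. Write $\sigma_{\max}(A)$ for the largest singular value of $A$ and $\sigma_{\min}(A_i)$ for the smallest of the $\min(m,n)$ singular values of $A_i$ (similarly $\sigma_{\min}(A)$). Assume $\sigma_{\min}(A_i)>0$ for all $i$ and put $\Theta=\sigma_{\max}(A)/\min_i\sigma_{\min}(A_i)$.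 **DFAL.** Given $c\in(0,1)$, $\mathbf x^{(0)}$ and $\lambda^{(1)},\alpha^{(1)},\xi^{(1)}>0$ with $\xi^{(1)}/\lambda^{(1)}<\min_i\tau_i$, put $\theta^{(1)}=0$, and for $k\ge1$ let $$f^{(k)}(\mathbf x)=\lambda^{(k)}\bar\gamma(\mathbf x)+\tfrac12\|A\mathbf x-b-\lambda^{(k)}\theta^{(k)}\|_2^2,\qquad P^{(k)}=\lambda^{(k)}\bar\rho+f^{(k)}.$$ Call $\mathbf x$ *acceptable* at step $k$ if (a) $P^{(k)}(\mathbf x)-\min P^{(k)}\le\alpha^{(k)}$, or (b) there are $g_i\in\lambda^{(k)}\partial\rho_i(x_i)+\nabla_{x_i}f^{(k)}(\mathbf x)$ with $\max_i\|g_i\|_2\le\xi^{(k)}/\sqrt N$. Run MS-APG on $P^{(k)}$ from $\mathbf y^{(0)}=\bar{\mathbf y}^{(1)}=\mathbf x^{(k-1)}$, $t^{(1)}=1$: for $\ell\ge1$, $$y_i^{(\ell)}=\mathbf{prox}_{\lambda^{(k)}\rho_i/L_i^{(k)}}\bigl(\bar y_i^{(\ell)}-\nabla_{y_i}f^{(k)}(\bar{\mathbf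 y}^{(\ell)})/L_i^{(k)}\bigr),\quad t^{(\ell+1)}=\tfrac12\Bigl(1+\sqrt{1+4(t^{(\ell)})^2}\Bigr),\quad \bar{\mathbf y}^{(\ell+1)}=\mathbf y^{(\ell)}+\tfrac{t^{(\ell)}-1}{t^{(\ell+1)}}(\mathbf y^{(\ell)}-\mathbf y^{(\ell-1)}),$$ where $L_i^{(k)}=\lambda^{(k)}L_{\gamma_i}+\sigma_{\max}^2(A)$ and $\mathbf{prox}_h(x)=\arg\min_y\{h(y)+\frac12\|y-x\|_2^2\}$. Let $N^{(k)}$ be the least $\ell\ge1$ such that $\mathbf y^{(\ell)}$ is acceptable, and set $\mathbf x^{(k)}=\mathbf y^{(N^{(k)})}$, $\theta^{(k+1)}=\theta^{(k)}-(A\mathbf x^{(k)}-b)/\lambda^{(k)}$, $\lambda^{(k+1)}=c\lambda^{(k)}$, $\alpha^{(k+1)}=c^2\alpha^{(k)}$, $\xi^{(k+1)}=c^2\xi^{(k)}$. For $\epsilon>0$ let $N^o(\epsilon)$ (resp. $N^f(\epsilon)$) be the least $K\ge1$ such that for all $k\ge K$ the iterate $\mathbf x^{(k)}$ is $\epsilon$-optimal,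 $|\bar F(\mathbf x^{(k)})-\bar F^*|\le\epsilon$ (resp. $\epsilon$-feasible, $\|A\mathbf x^{(k)}-b\|_2\le\epsilon$). **Theorem.** Let $s>0$ and $\kappa,D\in\mathbb R$. There is a constant $C>0$, depending only on $N$, $c$, $\lambda^{(1)},\alpha^{(1)},\xi^{(1)}$, the constants $\tau_i,B_i,G_i,L_{\gamma_i}$, and $s,\kappa,D$, such that whenever $\sigma_{\max}(A)\ge s$, $\bar F^*-\sum_i\underline\gamma_i\le D$, $\|\mathbf x^{(0)}\|_2\le D$, and, only in the case $m>n$, $\min_i\sigma_{\min}(A_i)\le\kappa\,\sigma_{\min}(A)$, all $N^{(k)}$ are finite, and for every $0<\epsilon\le1$ the numbers $N^o(\epsilon)$, $N^f(\epsilon)$ are finite with $$\sum_{k=1}^{N^o(\epsilon)}N^{(k)}\le C\,\Theta^2\sigma_{\max}(A)\,\epsilon^{-1},\qquad \sum_{k=1}^{N^f(\epsilon)}N^{(k)}\le C\,\Theta\,\sigma_{\max}(A)\,\epsilon^{-1}.$$ -/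

import Mathlib

open scoped InnerProductSpace

noncomputable section

namespace DFAL

/-- `ℝⁿ` with its Euclidean norm. -/
abbrev Vec (n : ℕ) : Type := EuclideanSpace ℝ (Fin n)

/-- `ℝ^{nN}`, as `N` blocks `x i ∈ ℝⁿ`, with the Euclidean norm of the concatenated vector. -/
abbrev BlockVec (N n : ℕ) : Type := PiLp 2 (fun _ : Fin N => Vec n)

/-! ### Singular values -/

section SingularValues

variable {E F : Type*} [NormedAddCommGroup E] [InnerProductSpace ℝ E] [FiniteDimensional ℝ E]
  [NormedAddCommGroup F] [InnerProductSpace ℝ F] [FiniteDimensional ℝ F]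

/-- The largest singular value. -/
def sigmaMax (T : E →ₗ[ℝ] F) : ℝ := T.singularValues 0

/-- The smallest of the `min (dim E) (dim F)` singular values `σ₁ ≥ σ₂ ≥ …` of `T : E → F`
(Mathlib numbers them from `0`). -/
def sigmaMin (T : E →ₗ[ℝ] F) : ℝ :=
  T.singularValues (min (Module.finrank ℝ E) (Module.finrank ℝ F) - 1)

end SingularValues

/-! ### The function classes -/

/-- `q` is a subgradient of `h` at `x`. -/
def IsSubgradient {n : ℕ} (h : Vec n → ℝ) (x q : Vec n) : Prop :=
  ∀ z, h x + ⟪q, z - x⟫_ℝ ≤ h z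

/-- `g` is convex, has an `L`-Lipschitz gradient, and is bounded below by `low`. -/
structure IsSmoothTerm {n : ℕ} (g : Vec n → ℝ) (L low : ℝ) : Prop where
  convex : ConvexOn ℝ Set.univ g
  differentiable : Differentiable ℝ g
  lipschitz : ∀ x y, ‖gradient g x - gradient g y‖ ≤ L * ‖x - y‖
  lower : ∀ x, low ≤ g x

/-- `h` is convex, all its subgradients have norm at most `B`, and `τ ‖x‖ ≤ h x` with `τ > 0`. -/
structure IsRegularizer {n : ℕ} (h : Vec n → ℝ) (B τ : ℝ) : Prop where
  convex : ConvexOn ℝ Set.univ h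
  bound_pos : 0 < B
  subgradient_le : ∀ x q, IsSubgradient h x q → ‖q‖ ≤ B
  tau_pos : 0 < τ
  coercive : ∀ x, τ * ‖x‖ ≤ h x

/-! ### The problem `min ∑ ρᵢ(xᵢ) + γᵢ(xᵢ)` subject to `∑ Aᵢ xᵢ = b` -/

/-- The data of the problem; `A i` is the `m × n` block `Aᵢ` of `A = [A₁, …, A_N]`. -/
structure Problem (N n m : ℕ) where
  rho : Fin N → Vec n → ℝ
  gamma : Fin N → Vec n → ℝ
  A : Fin N → (Vec n →ₗ[ℝ] Vec m)
  b : Vec m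

namespace Problem

variable {N n m : ℕ} (P : Problem N n m)

/-- The full map `A x = ∑ Aᵢ xᵢ`. -/
def fullA : BlockVec N n →ₗ[ℝ] Vec m :=
  ∑ i, (P.A i).comp (PiLp.proj 2 (fun _ : Fin N => Vec n) i : BlockVec N n →L[ℝ] Vec n).toLinearMap

def rhoBar (x : BlockVec N n) : ℝ := ∑ i, P.rho i (x i)

def gammaBar (x : BlockVec N n) : ℝ := ∑ i, P.gamma i (x i)

/-- The objective. -/
def F (x : BlockVec N n) : ℝ := P.rhoBar x + P.gammaBar x

/-- The optimal value. -/
def optVal : ℝ := sInf (P.F '' {x | P.fullA x = P.b})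

/-- `min_i σ_min(Aᵢ)`. -/
def minSigma : ℝ := ⨅ i, sigmaMin (P.A i)

/-- `Θ = σ_max(A) / min_i σ_min(Aᵢ)`. -/
def Theta : ℝ := sigmaMax P.fullA / P.minSigma

/-- `f(x) = λ γ̄(x) + ½ ‖A x - b - λ θ‖²`. -/
def smoothPart (lam : ℝ) (θ : Vec m) (x : BlockVec N n) : ℝ :=
  lam * P.gammaBar x + 1 / 2 * ‖P.fullA x - P.b - lam • θ‖ ^ 2

/-- The objective `λ ρ̄(x) + f(x)` of the subproblem. -/
def subObj (lam : ℝ) (θ : Vec m) (x : BlockVec N n) : ℝ :=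
  lam * P.rhoBar x + P.smoothPart lam θ x

/-- The inexactness condition for the subproblem: either
(a) `x` is `α`-optimal, or
(b) there are partial subgradients `gᵢ = λ qᵢ + ∇_{xᵢ} f(x)`, `qᵢ ∈ ∂ρᵢ(xᵢ)`, all of norm at most
`ξ / √N`. -/
def Accept (lam α ξ : ℝ) (θ : Vec m) (x : BlockVec N n) : Prop :=
  (∀ z, P.subObj lam θ x - P.subObj lam θ z ≤ α) ∨
  ∃ q : Fin N → Vec n, ∀ i, IsSubgradient (P.rho i) (x i) (q i) ∧
    ‖lam • q i + gradient (P.smoothPart lam θ) x i‖ ≤ ξ / Real.sqrt N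

end Problem

/-! ### The inner solver MS-APG -/

/-- `prox_h(x) = argmin_y h(y) + ½ ‖y - x‖²`. -/
def prox {n : ℕ} (h : Vec n → ℝ) (x : Vec n) : Vec n :=
  Classical.epsilon fun p => ∀ y, h p + 1 / 2 * ‖p - x‖ ^ 2 ≤ h y + 1 / 2 * ‖y - x‖ ^ 2

/-- After `ℓ` iterations: `y = y^(ℓ)`, `ybar = ȳ^(ℓ+1)`, `t = t^(ℓ+1)`. -/
structure APGState (N n : ℕ) where
  y : BlockVec N n
  ybar : BlockVec N n
  t : ℝ

/-- One MS-APG iteration for `∑ hᵢ(yᵢ) + f(y)` with step lengths `1 / Lᵢ`. -/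
def apgStep {N n : ℕ} (h : Fin N → Vec n → ℝ) (f : BlockVec N n → ℝ) (L : Fin N → ℝ)
    (s : APGState N n) : APGState N n :=
  let y' : BlockVec N n := WithLp.toLp 2 fun i =>
    prox (fun z => h i z / L i) (s.ybar i - (1 / L i) • gradient f s.ybar i)
  let t' : ℝ := (1 + Real.sqrt (1 + 4 * s.t ^ 2)) / 2
  { y := y'
    ybar := y' + ((s.t - 1) / t') • (y' - s.y)
    t := t' }

/-- The state after `ℓ` MS-APG iterations started at `y0`. -/
def apg {N n : ℕ} (h : Fin N → Vec n → ℝ) (f : BlockVec N n → ℝ) (L : Fin N → ℝ)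
    (y0 : BlockVec N n) : ℕ → APGState N n
  | 0 => { y := y0, ybar := y0, t := 1 }
  | ℓ + 1 => apgStep h f L (apg h f L y0 ℓ)

/-! ### The outer algorithm DFAL -/

/-- The state after `k` DFAL iterations:
`x = x^(k)`, `θ = θ^(k+1)`, `lam = λ^(k+1)`, `α = α^(k+1)`, `ξ = ξ^(k+1)`. -/
structure State (N n m : ℕ) where
  x : BlockVec N n
  θ : Vec m
  lam : ℝ
  α : ℝ
  ξ : ℝ

namespace Problem

variable {N n m : ℕ} (P : Problem N n m)

/-- The `ℓ`-th MS-APG iterate in the DFAL iteration that starts from the state `s`; the step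
lengths are `1 / Lᵢ` with `Lᵢ = λ L_{γᵢ} + σ_max(A)²`. -/
def innerIterate (Lγ : Fin N → ℝ) (s : State N n m) (ℓ : ℕ) : BlockVec N n :=
  (apg (fun i z => s.lam * P.rho i z) (P.smoothPart s.lam s.θ)
    (fun i => s.lam * Lγ i + sigmaMax P.fullA ^ 2) s.x ℓ).y

/-- The numbers `ℓ ≥ 1` of MS-APG iterations after which the inexactness condition holds. -/
def acceptedCounts (Lγ : Fin N → ℝ) (s : State N n m) : Set ℕ :=
  {ℓ | 1 ≤ ℓ ∧ P.Accept s.lam s.α s.ξ s.θ (P.innerIterate Lγ s ℓ)}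

/-- The number of MS-APG iterations made in the DFAL iteration that starts from `s`. -/
def innerCount (Lγ : Fin N → ℝ) (s : State N n m) : ℕ := sInf (P.acceptedCounts Lγ s)

/-- One DFAL iteration. -/
def dfalStep (Lγ : Fin N → ℝ) (c : ℝ) (s : State N n m) : State N n m :=
  let x' := P.innerIterate Lγ s (P.innerCount Lγ s)
  { x := x'
    θ := s.θ - (1 / s.lam) • (P.fullA x' - P.b)
    lam := c * s.lam
    α := c ^ 2 * s.α
    ξ := c ^ 2 * s.ξ }

/-- The state after `k` DFAL iterations, from `x^(0) = x0`, `θ^(1) = 0`, `λ^(1) = lam1`,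
`α^(1) = α1`, `ξ^(1) = ξ1`. -/
def dfal (Lγ : Fin N → ℝ) (c lam1 α1 ξ1 : ℝ) (x0 : BlockVec N n) : ℕ → State N n m
  | 0 => { x := x0, θ := 0, lam := lam1, α := α1, ξ := ξ1 }
  | k + 1 => P.dfalStep Lγ c (dfal Lγ c lam1 α1 ξ1 x0 k)

/-- Total number of MS-APG iterations made in the DFAL iterations `1, …, K`. -/
def totalInner (Lγ : Fin N → ℝ) (c lam1 α1 ξ1 : ℝ) (x0 : BlockVec N n) (K : ℕ) : ℕ :=
  ∑ k ∈ Finset.range K, P.innerCount Lγ (P.dfal Lγ c lam1 α1 ξ1 x0 k)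

def EpsOptimal (ε : ℝ) (x : BlockVec N n) : Prop := |P.F x - P.optVal| ≤ ε

def EpsFeasible (ε : ℝ) (x : BlockVec N n) : Prop := ‖P.fullA x - P.b‖ ≤ ε

end Problem

end DFAL

end

/-! Everything comes from comparing an accepted point `x` of a subproblem with well-chosen
competitors. If `θ'` is the updated multiplier, then `A x - b - λθ = -λθ'`, so the subproblem has
value `λ F(x) + λ²‖θ'‖²/2` at `x`. Either acceptance test makes `x` minimal up to `α + ξ ∑ ‖xᵢ -
zᵢ‖` (`Accept.approxMin`), with `α` and `ξ` proportional to `λ²`.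

Competitor 1: a constrained minimizer (`ApproxMin.value_le`, `ApproxMin.mul_blockSum_le`). The
margin in `ξ/λ < τᵢ` absorbs the `ξ` term and leaves `δ ∑ ‖xᵢ‖ + λ‖θ'‖²/2 ≤ const + λ‖θ‖²/2`. As `λ`
shrinks by the factor `c`, the energy `λ‖θ‖²` stays bounded, so iterates and exact subproblem
minimizers stay in a region whose size does not depend on `A`.

Competitor 2: `x + λd` with `A d = θ'` and `‖d‖` of order `‖θ'‖ / min σ_min(Aᵢ)`
(`ApproxMin.norm_sq_le`). It has zero penalty, while `F` changes by a Lipschitz amount, so `‖θ'‖²`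
is at most of order `1 + Θ‖θ'‖`, whence `‖θ'‖ = O(Θ)`. The infeasibility `λ‖θ - θ'‖` is therefore
`O(Θλ)`. The first comparison bounds `F(x) - F*` above by `O(Θ²λ)`; repairing feasibility with a
bounded right inverse gives the matching lower bound.

The accelerated rate (`apg_le`) yields error `O(σ_max(A)²/ℓ²)`, which is below `α` once `ℓ` is of
order `σ_max(A)/λ`. Since `λ` decreases geometrically, the last outer iteration dominates the total
cost, with `λ` of order `ε/Θ²` for optimality and `ε/Θ` for feasibility. -/

noncomputable section

namespace DFAL

/-! ### Subgradients and the descent lemma -/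

section Convex

/-- Separate `(x, h x)` from the open convex strict epigraph. The vertical coefficient `a` of the
separating functional is negative, so the hyperplane is a graph, and dividing by `-a` gives the
subgradient. -/
theorem _root_.ConvexOn.exists_isSubgradient {n : ℕ} {h : Vec n → ℝ}
    (hh : ConvexOn ℝ Set.univ h) (x : Vec n) : ∃ q, IsSubgradient h x q := by
  have hcont : Continuous h := hh.locallyLipschitz.continuous
  have hconv : Convex ℝ {p : Vec n × ℝ | p.1 ∈ Set.univ ∧ h p.1 < p.2} := hh.convex_strict_epigraph
  have hopen : IsOpen {p : Vec n × ℝ | p.1 ∈ Set.univ ∧ h p.1 < p.2} := by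
    simp only [Set.mem_univ, true_and]
    exact isOpen_lt (hcont.comp continuous_fst) continuous_snd
  obtain ⟨l, hl⟩ := geometric_hahn_banach_open_point hconv hopen
    (x := (x, h x)) (by simp)
  set a : ℝ := l (0, 1) with ha
  have hl' : ∀ z r, l (z, r) = l (z, 0) + r * a := by
    intro z r
    have : ((z, r) : Vec n × ℝ) = (z, 0) + r • (0, 1) := by simp
    rw [this, map_add, map_smul, smul_eq_mul]
  have hneg : a < 0 := by
    have := hl (x, h x + 1) (by simp)
    rw [hl' x (h x + 1), hl' x (h x)] at this
    linarith
  have key : ∀ z, l (z, 0) + h z * a ≤ l (x, 0) + h x * a := by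
    intro z
    -- The point `(z, h z)` is outside the strict epigraph, so it is raised by an amount costing
    -- `ε`.
    refine le_of_forall_pos_le_add fun ε hε => ?_
    have := hl (z, h z + ε / (-a)) (by simp; exact div_pos hε (by linarith))
    rw [hl' z, hl' x (h x)] at this
    have e : ε / (-a) * a = -ε := by
      rw [div_neg, neg_mul, div_mul_cancel₀ _ hneg.ne]
    linarith [add_mul (h z) (ε / (-a)) a]
  let u : Vec n →L[ℝ] ℝ := (-a)⁻¹ • l.comp (ContinuousLinearMap.inl ℝ (Vec n) ℝ)
  refine ⟨(InnerProductSpace.toDual ℝ (Vec n)).symm u, fun z => ?_⟩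
  rw [InnerProductSpace.toDual_symm_apply]
  have e : u (z - x) = (-a)⁻¹ * (l (z, 0) - l (x, 0)) := by
    simp only [u, smul_apply, ContinuousLinearMap.comp_apply,
      ContinuousLinearMap.inl_apply, smul_eq_mul]
    rw [← map_sub]; simp
  rw [e]
  have h1 : l (z, 0) - l (x, 0) ≤ (-a) * (h z - h x) := by linarith [key z]
  have h2 : (-a)⁻¹ * (l (z, 0) - l (x, 0)) ≤ (-a)⁻¹ * ((-a) * (h z - h x)) :=
    mul_le_mul_of_nonneg_left h1 (inv_nonneg.2 (by linarith))
  rw [inv_mul_cancel_left₀ (by linarith : (-a) ≠ 0)] at h2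
  linarith

theorem IsRegularizer.sub_le {n : ℕ} {h : Vec n → ℝ} {B τ : ℝ} (hh : IsRegularizer h B τ)
    (x y : Vec n) : h y - h x ≤ B * ‖y - x‖ := by
  obtain ⟨q, hq⟩ := hh.convex.exists_isSubgradient y
  have h1 := hq x
  have h2 : ⟪q, y - x⟫_ℝ ≤ ‖q‖ * ‖y - x‖ := real_inner_le_norm _ _
  have h3 := mul_le_mul_of_nonneg_right (hh.subgradient_le y q hq) (norm_nonneg (y - x))
  have h4 : ⟪q, x - y⟫_ℝ = -⟪q, y - x⟫_ℝ := by rw [← inner_neg_right, neg_sub]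
  linarith

variable {E : Type*} [NormedAddCommGroup E] [InnerProductSpace ℝ E] [CompleteSpace E]

theorem hasDerivAt_along_line {f : E → ℝ} (hf : Differentiable ℝ f) (x d : E) (t : ℝ) :
    HasDerivAt (fun t : ℝ => f (x + t • d)) ⟪gradient f (x + t • d), d⟫_ℝ t := by
  have h1 : HasDerivAt (fun t : ℝ => x + t • d) d t := by
    simpa using ((hasDerivAt_id t).smul_const d).const_add x
  rw [inner_gradient_left]
  exact (hf (x + t • d)).hasFDerivAt.comp_hasDerivAt t h1

theorem _root_.ConvexOn.add_inner_gradient_le {f : E → ℝ} (hc : ConvexOn ℝ Set.univ f)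
    (hf : Differentiable ℝ f) (x z : E) : f x + ⟪gradient f x, z - x⟫_ℝ ≤ f z := by
  have hφ : ConvexOn ℝ Set.univ (fun t : ℝ => f (x + t • (z - x))) := by
    have := hc.comp_affineMap (AffineMap.lineMap x z : ℝ →ᵃ[ℝ] E)
    refine (this.congr ?_)
    intro t _
    simp [AffineMap.lineMap_apply, add_comm]
  have hd := hasDerivAt_along_line hf x (z - x) 0
  have := hφ.le_slope_of_hasDerivAt (Set.mem_univ 0) (Set.mem_univ 1) one_pos hd
  simp only [slope, sub_zero, inv_one, zero_smul, add_zero, one_smul, vsub_eq_sub] at this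
  rw [add_sub_cancel] at this
  linarith

/-- Restrict to the segment and subtract the linear and quadratic terms: the Lipschitz bound makes
the derivative of what remains nonpositive. -/
theorem le_add_inner_gradient_add {f : E → ℝ} (hf : Differentiable ℝ f) {L : ℝ}
    (hL : ∀ x y, ‖gradient f x - gradient f y‖ ≤ L * ‖x - y‖) (x z : E) :
    f z ≤ f x + ⟪gradient f x, z - x⟫_ℝ + L / 2 * ‖z - x‖ ^ 2 := by
  set d := z - x with hd
  let ψ : ℝ → ℝ := fun t => f (x + t • d) - t * ⟪gradient f x, d⟫_ℝ - t ^ 2 * (L / 2 * ‖d‖ ^ 2)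
  have hψ : ∀ t, HasDerivAt ψ (⟪gradient f (x + t • d), d⟫_ℝ - 1 * ⟪gradient f x, d⟫_ℝ
      - (2 * t) * (L / 2 * ‖d‖ ^ 2)) t := by
    intro t
    refine ((hasDerivAt_along_line hf x d t).sub ((hasDerivAt_id t).mul_const _)).sub ?_
    simpa using (hasDerivAt_pow 2 t).mul_const (L / 2 * ‖d‖ ^ 2)
  have hanti : AntitoneOn ψ (Set.Icc 0 1) := by
    refine antitoneOn_of_deriv_nonpos (convex_Icc 0 1)
      (fun t _ => (hψ t).continuousAt.continuousWithinAt)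
      (fun t _ => (hψ t).differentiableAt.differentiableWithinAt) fun t ht => ?_
    rw [interior_Icc] at ht
    rw [(hψ t).deriv]
    have h1 : ⟪gradient f (x + t • d) - gradient f x, d⟫_ℝ
        ≤ ‖gradient f (x + t • d) - gradient f x‖ * ‖d‖ := real_inner_le_norm _ _
    have h2 := mul_le_mul_of_nonneg_right (hL (x + t • d) x) (norm_nonneg d)
    rw [add_sub_cancel_left, norm_smul, Real.norm_of_nonneg ht.1.le] at h2
    rw [inner_sub_left] at h1
    nlinarith
  have := hanti (by simp) (by simp) (zero_le_one : (0 : ℝ) ≤ 1)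
  simp only [ψ, one_smul, zero_smul, hd, add_sub_cancel, add_zero] at this
  simp only [hd]
  linarith

theorem IsSmoothTerm.sub_le {n : ℕ} {g : Vec n → ℝ} {L low G : ℝ} (hg : IsSmoothTerm g L low)
    (hG : ∀ x, ‖gradient g x‖ ≤ G) (x y : Vec n) : g y - g x ≤ G * ‖y - x‖ := by
  have h1 := hg.convex.add_inner_gradient_le hg.differentiable y x
  have h2 : ⟪gradient g y, y - x⟫_ℝ ≤ ‖gradient g y‖ * ‖y - x‖ := real_inner_le_norm _ _
  have h3 := mul_le_mul_of_nonneg_right (hG y) (norm_nonneg (y - x))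
  have h4 : ⟪gradient g y, x - y⟫_ℝ = -⟪gradient g y, y - x⟫_ℝ := by
    rw [← inner_neg_right, neg_sub]
  linarith

end Convex

/-! ### Singular values and norm-controlled preimages -/

section SingularValues

variable {E F : Type*} [NormedAddCommGroup E] [InnerProductSpace ℝ E] [FiniteDimensional ℝ E]
  [NormedAddCommGroup F] [InnerProductSpace ℝ F] [FiniteDimensional ℝ F] (T : E →ₗ[ℝ] F)

/-- Expand in an orthonormal eigenbasis of `T* T`, whose eigenvalues are the squared singular
values. -/
theorem norm_sq_apply_eq_sum (x : E) :
    ‖T x‖ ^ 2 = ∑ i : Fin (Module.finrank ℝ E), T.singularValues i ^ 2 *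
      ((T.isSymmetric_adjoint_comp_self.eigenvectorBasis rfl).repr x i) ^ 2 := by
  set hT := T.isSymmetric_adjoint_comp_self
  set e := hT.eigenvectorBasis rfl
  have h1 : ‖T x‖ ^ 2 = ⟪(LinearMap.adjoint T ∘ₗ T) x, x⟫_ℝ := by
    rw [LinearMap.comp_apply, LinearMap.adjoint_inner_left, real_inner_self_eq_norm_sq]
  rw [h1, ← e.repr.inner_map_map, PiLp.inner_apply]
  refine Finset.sum_congr rfl fun i _ => ?_
  rw [hT.eigenvectorBasis_apply_self_apply rfl, T.sq_singularValues_fin rfl i]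
  simp [e]
  ring

theorem norm_apply_le_sigmaMax (x : E) : ‖T x‖ ≤ sigmaMax T * ‖x‖ := by
  refine le_of_sq_le_sq ?_ (mul_nonneg (T.singularValues_nonneg 0) (norm_nonneg _))
  rw [norm_sq_apply_eq_sum, mul_pow,
    ← (T.isSymmetric_adjoint_comp_self.eigenvectorBasis rfl).repr.norm_map x,
    EuclideanSpace.norm_sq_eq, Finset.mul_sum]
  refine Finset.sum_le_sum fun i _ => ?_
  rw [Real.norm_eq_abs, sq_abs]
  refine mul_le_mul_of_nonneg_right ?_ (sq_nonneg _)
  exact pow_le_pow_left₀ (T.singularValues_nonneg _) (T.singularValues_antitone (Nat.zero_le _)) 2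

theorem sigmaMin_nonneg : 0 ≤ sigmaMin T := T.singularValues_nonneg _

/-- Already the largest singular value is at most `M`, being attained at the first eigenvector of
`T* T`. -/
theorem sigmaMin_le_of_forall_norm_apply_le {M : ℝ} (hM : 0 ≤ M)
    (h : ∀ x, ‖T x‖ ≤ M * ‖x‖) : sigmaMin T ≤ M := by
  refine (T.singularValues_antitone (Nat.zero_le _)).trans ?_
  rcases Nat.eq_zero_or_pos (Module.finrank ℝ E) with h0 | h0
  · rwa [T.singularValues_of_finrank_le h0.le]
  · set e := T.isSymmetric_adjoint_comp_self.eigenvectorBasis rfl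
    set i : Fin (Module.finrank ℝ E) := ⟨0, h0⟩ with hi
    have h1 := norm_sq_apply_eq_sum T (e i)
    have h2 := h (e i)
    rw [e.norm_eq_one, mul_one] at h2
    rw [Finset.sum_eq_single i (fun j _ hj => by
      simp [e, hj]) (by simp)] at h1
    have h3 : ‖T (e i)‖ ^ 2 = T.singularValues 0 ^ 2 := by
      rw [h1]; simp [e, hi]
    have h4 : ‖T (e i)‖ = T.singularValues 0 := by
      rwa [sq_eq_sq₀ (norm_nonneg _) (T.singularValues_nonneg _)] at h3
    linarith

/-- Positivity of the last singular value gives full rank, hence surjectivity. Take the preimage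
orthogonal to the kernel: its coordinates vanish along eigenvectors of index at least `dim F`, and
all other singular values are at least `sigmaMin T`. -/
theorem exists_preimage_sigmaMin_le (hd : Module.finrank ℝ F ≤ Module.finrank ℝ E)
    (hpos : 0 < sigmaMin T) (y : F) : ∃ x, T x = y ∧ sigmaMin T * ‖x‖ ≤ ‖y‖ := by
  have hσ : sigmaMin T = T.singularValues (Module.finrank ℝ F - 1) := by
    rw [sigmaMin, min_eq_right hd]
  rcases Nat.eq_zero_or_pos (Module.finrank ℝ F) with h0 | h0
  · have : Subsingleton F := Module.finrank_zero_iff.1 h0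
    exact ⟨0, Subsingleton.elim _ _, by simp⟩
  have hrank : Module.finrank ℝ F ≤ Module.finrank ℝ T.range := by
    have := T.singularValues_pos_iff_lt_finrank_range.1 (hσ ▸ hpos)
    omega
  have hsurj : Function.Surjective T := by
    rw [← LinearMap.range_eq_top]
    exact Submodule.eq_top_of_finrank_eq (le_antisymm (Submodule.finrank_le _) hrank)
  obtain ⟨x₀, hx₀⟩ := hsurj y
  set K := LinearMap.ker T
  set x := x₀ - K.starProjection x₀ with hx
  have hTx : T x = y := by
    have : T (K.starProjection x₀) = 0 := (K.orthogonalProjectionOnto x₀).2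
    rw [hx, map_sub, this, sub_zero, hx₀]
  have hperp : ∀ z ∈ K, ⟪z, x⟫_ℝ = 0 := by
    intro z hz
    exact (Submodule.mem_orthogonal K x).1 (Submodule.sub_starProjection_mem_orthogonal x₀) z hz
  refine ⟨x, hTx, le_of_sq_le_sq ?_ (norm_nonneg _)⟩
  set e := T.isSymmetric_adjoint_comp_self.eigenvectorBasis rfl
  rw [← hTx, norm_sq_apply_eq_sum, mul_pow, ← e.repr.norm_map x,
    EuclideanSpace.norm_sq_eq, Finset.mul_sum]
  refine Finset.sum_le_sum fun i _ => ?_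
  rw [Real.norm_eq_abs, sq_abs]
  by_cases hi : (i : ℕ) < Module.finrank ℝ F
  · refine mul_le_mul_of_nonneg_right (pow_le_pow_left₀ hpos.le ?_ 2) (sq_nonneg _)
    rw [hσ]
    exact T.singularValues_antitone (by omega)
  · have hz : T.singularValues i = 0 := by
      rw [T.singularValues_eq_zero_iff_le_finrank_range]
      exact (Submodule.finrank_le _).trans (not_lt.1 hi)
    have hTe : e i ∈ K := by
      rw [LinearMap.mem_ker, ← norm_eq_zero, ← sq_eq_zero_iff, norm_sq_apply_eq_sum]
      refine Finset.sum_eq_zero fun j _ => ?_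
      by_cases hj : j = i
      · rw [hj, hz]; simp
      · simp [e, hj]
    have : e.repr x i = 0 := by rw [e.repr_apply_apply]; exact hperp _ hTe
    rw [this]; simp

end SingularValues

/-! ### The proximal map -/

section Prox

variable {n : ℕ}

/-- Nonnegativity of `h` bounds a sublevel set, so a minimizer exists and the choice in `prox` is
meaningful. -/
theorem prox_isMin {h : Vec n → ℝ} (hc : ConvexOn ℝ Set.univ h) (h0 : ∀ y, 0 ≤ h y) (x y : Vec n) :
    h (prox h x) + 1 / 2 * ‖prox h x - x‖ ^ 2 ≤ h y + 1 / 2 * ‖y - x‖ ^ 2 := by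
  have hcont : Continuous h := hc.locallyLipschitz.continuous
  have : ∃ p, ∀ y, h p + 1 / 2 * ‖p - x‖ ^ 2 ≤ h y + 1 / 2 * ‖y - x‖ ^ 2 := by
    have hb : Continuous fun y : Vec n => h y + 1 / 2 * ‖y - x‖ ^ 2 := by fun_prop
    refine hb.exists_forall_le_of_isBounded x ?_
    refine (Metric.isBounded_closedBall (x := x) (r := 2 * h x + 1)).subset fun y hy => ?_
    simp only [sub_self, norm_zero, Set.mem_ofPred_eq] at hy
    rw [Metric.mem_closedBall, dist_eq_norm]
    nlinarith [h0 y, h0 x, norm_nonneg (y - x)]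
  exact Classical.epsilon_spec this y

/-- Compare the minimizer with `(1 - s) p + s y`, divide by `s` and let `s → 0`; the extra square
comes from the strong convexity of the quadratic term. -/
theorem prox_three_point {h : Vec n → ℝ} (hc : ConvexOn ℝ Set.univ h) (h0 : ∀ y, 0 ≤ h y)
    (x y : Vec n) :
    h (prox h x) + 1 / 2 * ‖prox h x - x‖ ^ 2 + 1 / 2 * ‖y - prox h x‖ ^ 2
      ≤ h y + 1 / 2 * ‖y - x‖ ^ 2 := by
  set p := prox h x with hp
  have key : ∀ s : ℝ, 0 < s → s < 1 →
      h p + 1 / 2 * ‖p - x‖ ^ 2 + (1 - s) * (1 / 2 * ‖y - p‖ ^ 2) ≤ h y + 1 / 2 * ‖y - x‖ ^ 2 := by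
    intro s hs0 hs1
    have h1 := prox_isMin hc h0 x ((1 - s) • p + s • y)
    have h2 := hc.2 (Set.mem_univ p) (Set.mem_univ y) (by linarith : 0 ≤ 1 - s) hs0.le (by ring)
    have h3 : ‖(1 - s) • p + s • y - x‖ ^ 2
        = (1 - s) * ‖p - x‖ ^ 2 + s * ‖y - x‖ ^ 2 - s * (1 - s) * ‖y - p‖ ^ 2 := by
      have e1 : (1 - s) • p + s • y - x = (p - x) + s • (y - p) := by module
      have e2 : y - x = (p - x) + (y - p) := by abel
      rw [e1, e2, norm_add_sq_real, norm_add_sq_real, inner_smul_right, norm_smul,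
        Real.norm_of_nonneg hs0.le]
      ring
    rw [h3] at h1
    simp only [smul_eq_mul] at h2
    rw [← hp] at h1
    nlinarith
  have ht : Filter.Tendsto (fun s : ℝ => h p + 1 / 2 * ‖p - x‖ ^ 2 +
      (1 - s) * (1 / 2 * ‖y - p‖ ^ 2)) (nhdsWithin 0 (Set.Ioi 0))
      (nhds (h p + 1 / 2 * ‖p - x‖ ^ 2 + (1 - 0) * (1 / 2 * ‖y - p‖ ^ 2))) := by
    refine Filter.Tendsto.mono_left ?_ nhdsWithin_le_nhds
    exact (by fun_prop : Continuous (fun s : ℝ => h p + 1 / 2 * ‖p - x‖ ^ 2 +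
      (1 - s) * (1 / 2 * ‖y - p‖ ^ 2))).tendsto 0
  rw [sub_zero, one_mul] at ht
  refine le_of_tendsto ht ?_
  filter_upwards [Ioo_mem_nhdsGT (zero_lt_one' ℝ)] with s hs using key s hs.1 hs.2

end Prox

/-! ### The accelerated rate in a block-weighted norm -/

section APG

variable {N n : ℕ}

/-- The squared norm `∑ Lᵢ ‖dᵢ‖²`. -/
def weightedSq (L : Fin N → ℝ) (d : BlockVec N n) : ℝ := ∑ i, L i * ‖d i‖ ^ 2

theorem weightedSq_smul (L : Fin N → ℝ) (r : ℝ) (d : BlockVec N n) :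
    weightedSq L (r • d) = r ^ 2 * weightedSq L d := by
  simp only [weightedSq, Finset.mul_sum]
  refine Finset.sum_congr rfl fun i _ => ?_
  rw [PiLp.smul_apply, norm_smul, mul_pow, Real.norm_eq_abs, sq_abs]
  ring

theorem weightedSq_nonneg {L : Fin N → ℝ} (hL : ∀ i, 0 ≤ L i) (d : BlockVec N n) :
    0 ≤ weightedSq L d :=
  Finset.sum_nonneg fun i _ => mul_nonneg (hL i) (sq_nonneg _)

variable {h : Fin N → Vec n → ℝ} {f : BlockVec N n → ℝ} {L : Fin N → ℝ}

/-- Scaling the three-point inequality of block `i` by `L i` and expanding the squares produces the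
linear model of `f` at `s.ybar`. Convexity bounds this model at `z`, and the descent inequality
bounds `f` at the new point. -/
theorem apgStep_le (hL : ∀ i, 0 < L i) (hc : ∀ i, ConvexOn ℝ Set.univ (h i))
    (h0 : ∀ i y, 0 ≤ h i y)
    (hf1 : ∀ x z, f x + ⟪gradient f x, z - x⟫_ℝ ≤ f z)
    (hf2 : ∀ x z, f z ≤ f x + ⟪gradient f x, z - x⟫_ℝ + 1 / 2 * weightedSq L (z - x))
    (s : APGState N n) (z : BlockVec N n) :
    ∑ i, h i ((apgStep h f L s).y i) + f (apgStep h f L s).y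
        + 1 / 2 * weightedSq L (z - (apgStep h f L s).y)
      ≤ ∑ i, h i (z i) + f z + 1 / 2 * weightedSq L (z - s.ybar) := by
  set p := (apgStep h f L s).y with hp
  set g := gradient f s.ybar with hg
  have hblock : ∀ i, h i (p i) + ⟪g i, (p - s.ybar) i⟫_ℝ + 1 / 2 * (L i * ‖(p - s.ybar) i‖ ^ 2)
      + 1 / 2 * (L i * ‖(z - p) i‖ ^ 2)
      ≤ h i (z i) + ⟪g i, (z - s.ybar) i⟫_ℝ + 1 / 2 * (L i * ‖(z - s.ybar) i‖ ^ 2) := by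
    intro i
    have hLi := hL i
    have h1 := prox_three_point (h := fun z => h i z / L i)
      (by simpa [div_eq_inv_mul] using (hc i).smul (inv_nonneg.2 hLi.le))
      (fun y => div_nonneg (h0 i y) hLi.le) (s.ybar i - (1 / L i) • g i) (z i)
    have hpi : prox (fun z => h i z / L i) (s.ybar i - (1 / L i) • g i) = p i := by
      simp [hp, apgStep, hg]
    rw [hpi] at h1
    have e : ∀ w : Vec n, L i * ‖w - (s.ybar i - (1 / L i) • g i)‖ ^ 2
        = L i * ‖w - s.ybar i‖ ^ 2 + 2 * ⟪g i, w - s.ybar i⟫_ℝ + ‖g i‖ ^ 2 / L i := by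
      intro w
      have : w - (s.ybar i - (1 / L i) • g i) = (w - s.ybar i) + (1 / L i) • g i := by abel
      rw [this, norm_add_sq_real, inner_smul_right, norm_smul, real_inner_comm,
        Real.norm_of_nonneg (by positivity)]
      field_simp
    have h2 := mul_le_mul_of_nonneg_left h1 hLi.le
    have e1 := e (p i)
    have e2 := e (z i)
    have e3 : L i * (h i (p i) / L i) = h i (p i) := mul_div_cancel₀ _ hLi.ne'
    have e4 : L i * (h i (z i) / L i) = h i (z i) := mul_div_cancel₀ _ hLi.ne'
    simp only [PiLp.sub_apply]
    nlinarith
  have hsum := Finset.sum_le_sum fun i (_ : i ∈ Finset.univ) => hblock i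
  simp only [Finset.sum_add_distrib, ← Finset.mul_sum] at hsum
  have i1 : ∀ d : BlockVec N n, ⟪g, d⟫_ℝ = ∑ i, ⟪g i, d i⟫_ℝ := fun d => PiLp.inner_apply g d
  have h3 := hf2 s.ybar p
  have h4 := hf1 s.ybar z
  rw [← hg, i1] at h3 h4
  simp only [weightedSq] at h3 ⊢
  linarith

theorem apg_t_ge (y0 : BlockVec N n) (ℓ : ℕ) : ((ℓ : ℝ) + 2) / 2 ≤ (apg h f L y0 ℓ).t := by
  induction ℓ with
  | zero => simp [apg]
  | succ ℓ ih =>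
    simp only [apg, apgStep]
    have h1 : 2 * (apg h f L y0 ℓ).t ≤ Real.sqrt (1 + 4 * (apg h f L y0 ℓ).t ^ 2) :=
      Real.le_sqrt_of_sq_le (by nlinarith)
    push_cast
    linarith

theorem apgStep_t_sq (s : APGState N n) :
    (apgStep h f L s).t ^ 2 - (apgStep h f L s).t = s.t ^ 2 := by
  simp only [apgStep]
  have := Real.sq_sqrt (by positivity : 0 ≤ 1 + 4 * s.t ^ 2)
  nlinarith

/-- This is a Lyapunov function that never increases. It starts at the right-hand side because `t =
1` kills the objective term, and `apgStep_t_sq` makes successive weights match. -/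
theorem apg_invariant (hL : ∀ i, 0 < L i) (hc : ∀ i, ConvexOn ℝ Set.univ (h i))
    (h0 : ∀ i y, 0 ≤ h i y)
    (hP : ConvexOn ℝ Set.univ fun x : BlockVec N n => ∑ i, h i (x i) + f x)
    (hf1 : ∀ x z, f x + ⟪gradient f x, z - x⟫_ℝ ≤ f z)
    (hf2 : ∀ x z, f z ≤ f x + ⟪gradient f x, z - x⟫_ℝ + 1 / 2 * weightedSq L (z - x))
    (y0 z : BlockVec N n) (ℓ : ℕ) :
    ((apg h f L y0 ℓ).t ^ 2 - (apg h f L y0 ℓ).t) *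
        ((∑ i, h i ((apg h f L y0 ℓ).y i) + f (apg h f L y0 ℓ).y) - (∑ i, h i (z i) + f z))
      + 1 / 2 * weightedSq L (z - ((apg h f L y0 ℓ).t • (apg h f L y0 ℓ).ybar
          - ((apg h f L y0 ℓ).t - 1) • (apg h f L y0 ℓ).y))
      ≤ 1 / 2 * weightedSq L (z - y0) := by
  induction ℓ with
  | zero => simp [apg]
  | succ ℓ ih =>
    refine le_trans ?_ ih
    have ht := apg_t_ge (h := h) (f := f) (L := L) y0 ℓ
    have ht1 : 1 ≤ (apg h f L y0 ℓ).t := by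
      have : (0 : ℝ) ≤ ℓ := Nat.cast_nonneg ℓ
      linarith
    have ht' := apg_t_ge (h := h) (f := f) (L := L) y0 (ℓ + 1)
    rw [show apg h f L y0 (ℓ + 1) = apgStep h f L (apg h f L y0 ℓ) from rfl] at ht' ⊢
    rw [apgStep_t_sq]
    set s := apg h f L y0 ℓ
    set t := s.t
    have htp : 0 < t := by linarith
    have htp' : 0 < (apgStep h f L s).t := lt_of_lt_of_le (by positivity) ht'
    set p := (apgStep h f L s).y with hp
    have hv : (apgStep h f L s).t • (apgStep h f L s).ybar - ((apgStep h f L s).t - 1) • p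
        = t • p - (t - 1) • s.y := by
      have hy : (apgStep h f L s).ybar = p + ((t - 1) / (apgStep h f L s).t) • (p - s.y) := rfl
      rw [hy, smul_add, smul_smul, mul_div_cancel₀ _ htp'.ne']
      module
    rw [hv]
    -- Testing the step at this convex combination of the current iterate and `z` turns both
    -- distances into `1 / t²` times the Lyapunov distances.
    set w : BlockVec N n := (1 - 1 / t) • s.y + (1 / t) • z with hw
    have h1 := apgStep_le hL hc h0 hf1 hf2 s w
    rw [← hp] at h1
    have h2 := hP.2 (Set.mem_univ s.y) (Set.mem_univ z)
      (by rw [sub_nonneg, div_le_one htp]; exact ht1 : 0 ≤ 1 - 1 / t)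
      (by positivity : 0 ≤ 1 / t) (by ring)
    simp only [smul_eq_mul] at h2
    rw [← hw] at h2
    have htw : t • w = (t - 1) • s.y + z := by
      rw [hw, smul_add, smul_smul, smul_smul, mul_sub, mul_one_div_cancel htp.ne', mul_one, one_smul]
    have e1 : weightedSq L (z - (t • p - (t - 1) • s.y)) = t ^ 2 * weightedSq L (w - p) := by
      rw [← weightedSq_smul, smul_sub, htw]; congr 1; abel
    have e2 : weightedSq L (z - (t • s.ybar - (t - 1) • s.y))
        = t ^ 2 * weightedSq L (w - s.ybar) := by
      rw [← weightedSq_smul, smul_sub, htw]; congr 1; abel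
    rw [e1, e2]
    have h3 := mul_le_mul_of_nonneg_left (h1.trans (add_le_add_left h2 _)) (sq_nonneg t)
    have e3 : t ^ 2 * (1 - 1 / t) = t ^ 2 - t := by field_simp
    have e4 : t ^ 2 * (1 / t) = t := by field_simp
    set Pp := ∑ i, h i (p i) + f p
    set Py := ∑ i, h i (s.y i) + f s.y
    set Pz := ∑ i, h i (z i) + f z
    have e5 : t ^ 2 * ((1 - 1 / t) * Py + 1 / t * Pz) = (t ^ 2 - t) * Py + t * Pz := by
      rw [mul_add, ← mul_assoc, ← mul_assoc, e3, e4]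
    linarith

/-- After at least one step, the weight `t² - t` is the square of the preceding `t`, hence at least
`((ℓ + 1) / 2)²`. -/
theorem apg_le (hL : ∀ i, 0 < L i) (hc : ∀ i, ConvexOn ℝ Set.univ (h i))
    (h0 : ∀ i y, 0 ≤ h i y)
    (hP : ConvexOn ℝ Set.univ fun x : BlockVec N n => ∑ i, h i (x i) + f x)
    (hf1 : ∀ x z, f x + ⟪gradient f x, z - x⟫_ℝ ≤ f z)
    (hf2 : ∀ x z, f z ≤ f x + ⟪gradient f x, z - x⟫_ℝ + 1 / 2 * weightedSq L (z - x))
    (y0 z : BlockVec N n) {ℓ : ℕ} (hℓ : 1 ≤ ℓ) :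
    ((ℓ : ℝ) + 1) ^ 2 * ((∑ i, h i ((apg h f L y0 ℓ).y i) + f (apg h f L y0 ℓ).y)
      - (∑ i, h i (z i) + f z)) ≤ 2 * weightedSq L (z - y0) := by
  obtain ⟨ℓ, rfl⟩ := Nat.exists_eq_add_of_le' hℓ
  have h1 := apg_invariant hL hc h0 hP hf1 hf2 y0 z (ℓ + 1)
  have h2 := apg_t_ge (h := h) (f := f) (L := L) y0 ℓ
  have h3 : (apg h f L y0 (ℓ + 1)).t ^ 2 - (apg h f L y0 (ℓ + 1)).t = (apg h f L y0 ℓ).t ^ 2 :=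
    apgStep_t_sq _
  rw [h3] at h1
  have h4 := weightedSq_nonneg (fun i => (hL i).le) (z - ((apg h f L y0 (ℓ + 1)).t •
    (apg h f L y0 (ℓ + 1)).ybar - ((apg h f L y0 (ℓ + 1)).t - 1) • (apg h f L y0 (ℓ + 1)).y))
  have h5 := weightedSq_nonneg (fun i => (hL i).le) (z - y0)
  set Δ := (∑ i, h i ((apg h f L y0 (ℓ + 1)).y i) + f (apg h f L y0 (ℓ + 1)).y)
      - (∑ i, h i (z i) + f z)
  push_cast
  rcases le_total Δ 0 with hΔ | hΔ
  · nlinarith [sq_nonneg ((ℓ : ℝ) + 1 + 1)]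
  · have h6 : ((ℓ : ℝ) + 1 + 1) ^ 2 ≤ 4 * (apg h f L y0 ℓ).t ^ 2 := by
      have : (0 : ℝ) ≤ ℓ := Nat.cast_nonneg ℓ
      nlinarith
    nlinarith [mul_le_mul_of_nonneg_right h6 hΔ]

end APG

/-! ### Convexity and smoothness of the subproblem -/

namespace Problem

instance instContinuousSMulBlockVec (N n : ℕ) : ContinuousSMul ℝ (BlockVec N n) :=
  IsBoundedSMul.continuousSMul

variable {N n m : ℕ} (P : Problem N n m)

theorem fullA_apply (x : BlockVec N n) : P.fullA x = ∑ i, P.A i (x i) := by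
  simp [fullA]

theorem fullA_single [DecidableEq (Fin N)] (i : Fin N) (v : Vec n) :
    P.fullA (PiLp.single 2 i v) = P.A i v := by
  rw [fullA_apply, Finset.sum_eq_single i]
  · simp
  · intro j _ hj; simp [hj]
  · simp

/-- `P.fullA` as a continuous linear map. -/
def fullACLM : BlockVec N n →L[ℝ] Vec m :=
  P.fullA.mkContinuous (sigmaMax P.fullA) (norm_apply_le_sigmaMax P.fullA)

variable {P} {B τ G Lγ low : Fin N → ℝ}

theorem convexOn_rhoBar (hρ : ∀ i, IsRegularizer (P.rho i) (B i) (τ i)) :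
    ConvexOn ℝ Set.univ P.rhoBar := by
  have := Finset.univ.sum_induction
    (fun i => fun x : BlockVec N n => P.rho i (x i)) (ConvexOn ℝ Set.univ)
    (fun _ _ => ConvexOn.add) (convexOn_const 0 convex_univ)
    fun i _ => (hρ i).convex.comp_linearMap (PiLp.proj 2 (fun _ : Fin N => Vec n) i :
      BlockVec N n →L[ℝ] Vec n).toLinearMap
  refine this.congr fun x _ => ?_
  simp [rhoBar]

theorem convexOn_gammaBar (hγ : ∀ i, IsSmoothTerm (P.gamma i) (Lγ i) (low i)) :
    ConvexOn ℝ Set.univ P.gammaBar := by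
  have := Finset.univ.sum_induction
    (fun i => fun x : BlockVec N n => P.gamma i (x i)) (ConvexOn ℝ Set.univ)
    (fun _ _ => ConvexOn.add) (convexOn_const 0 convex_univ)
    fun i _ => (hγ i).convex.comp_linearMap (PiLp.proj 2 (fun _ : Fin N => Vec n) i :
      BlockVec N n →L[ℝ] Vec n).toLinearMap
  refine this.congr fun x _ => ?_
  simp [gammaBar]

theorem convexOn_half_norm_sq (v : Vec m) :
    ConvexOn ℝ Set.univ fun x : BlockVec N n => 1 / 2 * ‖P.fullA x - v‖ ^ 2 := by
  refine ⟨convex_univ, fun x _ y _ a b ha hb hab => ?_⟩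
  have e : P.fullA (a • x + b • y) - v = a • (P.fullA x - v) + b • (P.fullA y - v) := by
    have : v = a • v + b • v := by rw [← add_smul, hab, one_smul]
    rw [map_add, map_smul, map_smul]
    nth_rewrite 1 [this]
    module
  have hb' : b = 1 - a := by linarith
  simp only [e, smul_eq_mul]
  rw [norm_add_sq_real, inner_smul_left, inner_smul_right, norm_smul, norm_smul,
    Real.norm_of_nonneg ha, Real.norm_of_nonneg hb]
  have h1 := real_inner_le_norm (P.fullA x - v) (P.fullA y - v)
  have h2 : 0 ≤ a * b := mul_nonneg ha hb
  have h3 := mul_le_mul_of_nonneg_left h1 h2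
  have h4 := mul_nonneg h2 (sq_nonneg (‖P.fullA x - v‖ - ‖P.fullA y - v‖))
  simp only [conj_trivial]
  subst hb'
  nlinarith

theorem convexOn_subObj (hρ : ∀ i, IsRegularizer (P.rho i) (B i) (τ i))
    (hγ : ∀ i, IsSmoothTerm (P.gamma i) (Lγ i) (low i)) {lam : ℝ} (hlam : 0 ≤ lam) (θ : Vec m) :
    ConvexOn ℝ Set.univ (P.subObj lam θ) := by
  have := ((convexOn_rhoBar hρ).smul hlam).add
    (((convexOn_gammaBar hγ).smul hlam).add (P.convexOn_half_norm_sq (P.b + lam • θ)))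
  refine this.congr fun x _ => ?_
  simp [subObj, smoothPart, sub_sub]

theorem continuous_rhoBar (hρ : ∀ i, IsRegularizer (P.rho i) (B i) (τ i)) :
    Continuous P.rhoBar := (convexOn_rhoBar hρ).locallyLipschitz.continuous

theorem continuous_gammaBar (hγ : ∀ i, IsSmoothTerm (P.gamma i) (Lγ i) (low i)) :
    Continuous P.gammaBar := (convexOn_gammaBar hγ).locallyLipschitz.continuous

theorem half_norm_sq_add (u w : Vec m) :
    1 / 2 * ‖u + w‖ ^ 2 = 1 / 2 * ‖u‖ ^ 2 + ⟪u, w⟫_ℝ + 1 / 2 * ‖w‖ ^ 2 := by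
  rw [norm_add_sq_real]; ring

theorem hasFDerivAt_smoothPart (hγ : ∀ i, IsSmoothTerm (P.gamma i) (Lγ i) (low i)) (lam : ℝ)
    (θ : Vec m) (x : BlockVec N n) :
    HasFDerivAt (P.smoothPart lam θ)
      (lam • (∑ i, (fderiv ℝ (P.gamma i) (x i)).comp (PiLp.proj 2 (fun _ : Fin N => Vec n) i))
        + (1 / 2 : ℝ) • (2 • (innerSL ℝ (P.fullA x - P.b - lam • θ)).comp
            P.fullACLM)) x := by
  have h1 : HasFDerivAt P.gammaBar
      (∑ i, (fderiv ℝ (P.gamma i) (x i)).comp (PiLp.proj 2 (fun _ : Fin N => Vec n) i)) x := by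
    have := HasFDerivAt.fun_sum (u := Finset.univ)
      (A := fun i => fun x : BlockVec N n => P.gamma i (x i)) (x := x)
      (A' := fun i => (fderiv ℝ (P.gamma i) (x i)).comp (PiLp.proj 2 (fun _ : Fin N => Vec n) i))
      fun i _ => ((hγ i).differentiable (x i)).hasFDerivAt.comp x
        (PiLp.proj 2 (fun _ : Fin N => Vec n) i : BlockVec N n →L[ℝ] Vec n).hasFDerivAt
    exact this
  have h2 : HasFDerivAt (fun x => P.fullA x - P.b - lam • θ) P.fullACLM x :=
    (P.fullACLM.hasFDerivAt.sub_const P.b).sub_const (lam • θ)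
  exact (h1.const_mul lam).add ((h2.norm_sq).const_mul (1 / 2))

theorem inner_gradient_smoothPart (hγ : ∀ i, IsSmoothTerm (P.gamma i) (Lγ i) (low i)) (lam : ℝ)
    (θ : Vec m) (x d : BlockVec N n) :
    ⟪gradient (P.smoothPart lam θ) x, d⟫_ℝ
      = lam * ∑ i, ⟪gradient (P.gamma i) (x i), d i⟫_ℝ
        + ⟪P.fullA x - P.b - lam • θ, P.fullA d⟫_ℝ := by
  rw [inner_gradient_left, (hasFDerivAt_smoothPart hγ lam θ x).fderiv]
  rw [inner_sub_left, inner_sub_left, real_inner_smul_left]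
  simp [inner_gradient_left, fullACLM]

theorem smoothPart_eq_add (lam : ℝ) (θ : Vec m) (x z : BlockVec N n) :
    P.smoothPart lam θ z = lam * P.gammaBar z + 1 / 2 * ‖P.fullA x - P.b - lam • θ‖ ^ 2
      + ⟪P.fullA x - P.b - lam • θ, P.fullA (z - x)⟫_ℝ + 1 / 2 * ‖P.fullA (z - x)‖ ^ 2 := by
  have e : P.fullA z - P.b - lam • θ = (P.fullA x - P.b - lam • θ) + P.fullA (z - x) := by
    rw [map_sub]; abel
  rw [smoothPart, e, half_norm_sq_add]
  ring

theorem smoothPart_add_inner_le (hγ : ∀ i, IsSmoothTerm (P.gamma i) (Lγ i) (low i)) {lam : ℝ}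
    (hlam : 0 ≤ lam) (θ : Vec m) (x z : BlockVec N n) :
    P.smoothPart lam θ x + ⟪gradient (P.smoothPart lam θ) x, z - x⟫_ℝ ≤ P.smoothPart lam θ z := by
  rw [inner_gradient_smoothPart hγ, smoothPart_eq_add lam θ x z, smoothPart]
  have h1 : P.gammaBar x + ∑ i, ⟪gradient (P.gamma i) (x i), (z - x) i⟫_ℝ ≤ P.gammaBar z := by
    rw [gammaBar, gammaBar, ← Finset.sum_add_distrib]
    exact Finset.sum_le_sum fun i _ =>
      (hγ i).convex.add_inner_gradient_le (hγ i).differentiable (x i) (z i)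
  nlinarith [mul_le_mul_of_nonneg_left h1 hlam, sq_nonneg ‖P.fullA (z - x)‖]

/-- The penalty couples the blocks only through `‖A d‖² ≤ σ_max(A)² ∑ ‖dᵢ‖²`, which is why each step
constant contains the full `σ_max(A)²`. -/
theorem smoothPart_le_add (hγ : ∀ i, IsSmoothTerm (P.gamma i) (Lγ i) (low i)) {lam : ℝ}
    (hlam : 0 ≤ lam) (θ : Vec m) (x z : BlockVec N n) :
    P.smoothPart lam θ z ≤ P.smoothPart lam θ x + ⟪gradient (P.smoothPart lam θ) x, z - x⟫_ℝ
      + 1 / 2 * weightedSq (fun i => lam * Lγ i + sigmaMax P.fullA ^ 2) (z - x) := by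
  rw [inner_gradient_smoothPart hγ, smoothPart_eq_add lam θ x z, smoothPart]
  have h1 : P.gammaBar z ≤ P.gammaBar x + ∑ i, ⟪gradient (P.gamma i) (x i), (z - x) i⟫_ℝ
      + ∑ i, Lγ i / 2 * ‖(z - x) i‖ ^ 2 := by
    rw [gammaBar, gammaBar, ← Finset.sum_add_distrib, ← Finset.sum_add_distrib]
    exact Finset.sum_le_sum fun i _ =>
      le_add_inner_gradient_add (hγ i).differentiable (hγ i).lipschitz (x i) (z i)
  have h2 : ‖P.fullA (z - x)‖ ^ 2 ≤ sigmaMax P.fullA ^ 2 * ∑ i, ‖(z - x) i‖ ^ 2 := by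
    rw [← PiLp.norm_sq_eq_of_L2, ← mul_pow]
    exact pow_le_pow_left₀ (norm_nonneg _) (norm_apply_le_sigmaMax _ _) 2
  have h3 : 1 / 2 * weightedSq (fun i => lam * Lγ i + sigmaMax P.fullA ^ 2) (z - x)
      = lam * ∑ i, Lγ i / 2 * ‖(z - x) i‖ ^ 2
        + 1 / 2 * (sigmaMax P.fullA ^ 2 * ∑ i, ‖(z - x) i‖ ^ 2) := by
    simp only [weightedSq, Finset.mul_sum, ← Finset.sum_add_distrib]
    exact Finset.sum_congr rfl fun i _ => by ring
  rw [h3]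
  nlinarith [mul_le_mul_of_nonneg_left h1 hlam]

/-- The sum of the norms of the blocks. -/
def _root_.DFAL.blockSum (x : BlockVec N n) : ℝ := ∑ i, ‖x i‖

theorem _root_.DFAL.blockSum_nonneg (x : BlockVec N n) : 0 ≤ blockSum x :=
  Finset.sum_nonneg fun _ _ => norm_nonneg _

theorem _root_.DFAL.blockSum_sub_le (x y : BlockVec N n) :
    blockSum (x - y) ≤ blockSum x + blockSum y := by
  rw [blockSum, blockSum, blockSum, ← Finset.sum_add_distrib]
  exact Finset.sum_le_sum fun i _ => norm_sub_le _ _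

theorem _root_.DFAL.blockSum_le (x : BlockVec N n) : blockSum x ≤ N * ‖x‖ := by
  have : blockSum x ≤ ∑ _i : Fin N, ‖x‖ := Finset.sum_le_sum fun i _ => PiLp.norm_apply_le x i
  simpa using this

theorem _root_.DFAL.norm_le_blockSum (x : BlockVec N n) : ‖x‖ ≤ blockSum x := by
  refine le_of_sq_le_sq ?_ (blockSum_nonneg x)
  rw [PiLp.norm_sq_eq_of_L2]
  exact Finset.sum_sq_le_sq_sum_of_nonneg fun i _ => norm_nonneg _

/-! ### Lipschitz and coercivity bounds; existence of minimizers -/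

theorem F_sub_le (hρ : ∀ i, IsRegularizer (P.rho i) (B i) (τ i))
    (hγ : ∀ i, IsSmoothTerm (P.gamma i) (Lγ i) (low i))
    (hG : ∀ i x, ‖gradient (P.gamma i) x‖ ≤ G i) {M : ℝ} (hM : ∀ i, B i + G i ≤ M)
    (x d : BlockVec N n) : P.F (x + d) ≤ P.F x + M * blockSum d := by
  have h : ∀ i, P.rho i ((x + d) i) + P.gamma i ((x + d) i)
      ≤ P.rho i (x i) + P.gamma i (x i) + M * ‖d i‖ := by
    intro i
    have h1 := (hρ i).sub_le (x i) ((x + d) i)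
    have h2 := (hγ i).sub_le (hG i) (x i) ((x + d) i)
    have e : (x + d) i - x i = d i := by simp
    rw [e] at h1 h2
    nlinarith [mul_le_mul_of_nonneg_right (hM i) (norm_nonneg (d i))]
  have := Finset.sum_le_sum fun i (_ : i ∈ Finset.univ) => h i
  simp only [Finset.sum_add_distrib, ← Finset.mul_sum] at this
  exact this

theorem sum_low_add_le_F (hρ : ∀ i, IsRegularizer (P.rho i) (B i) (τ i))
    (hγ : ∀ i, IsSmoothTerm (P.gamma i) (Lγ i) (low i)) {t : ℝ} (ht : ∀ i, t ≤ τ i)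
    (x : BlockVec N n) : ∑ i, low i + t * blockSum x ≤ P.F x := by
  rw [F, add_comm, blockSum, Finset.mul_sum]
  refine add_le_add (Finset.sum_le_sum fun i _ => ?_) (Finset.sum_le_sum fun i _ => (hγ i).lower _)
  exact (mul_le_mul_of_nonneg_right (ht i) (norm_nonneg _)).trans ((hρ i).coercive _)

theorem subObj_eq (lam : ℝ) (θ : Vec m) (x : BlockVec N n) :
    P.subObj lam θ x = lam * P.F x + 1 / 2 * ‖P.fullA x - P.b - lam • θ‖ ^ 2 := by
  rw [subObj, smoothPart, F]; ring

theorem continuous_F (hρ : ∀ i, IsRegularizer (P.rho i) (B i) (τ i))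
    (hγ : ∀ i, IsSmoothTerm (P.gamma i) (Lγ i) (low i)) : Continuous P.F :=
  (continuous_rhoBar hρ).add (continuous_gammaBar hγ)

theorem isBounded_F_le (hρ : ∀ i, IsRegularizer (P.rho i) (B i) (τ i))
    (hγ : ∀ i, IsSmoothTerm (P.gamma i) (Lγ i) (low i)) {t : ℝ} (ht0 : 0 < t)
    (ht : ∀ i, t ≤ τ i) (a : ℝ) : Bornology.IsBounded {x | P.F x ≤ a} := by
  refine (Metric.isBounded_closedBall (x := 0) (r := (a - ∑ i, low i) / t)).subset fun x hx => ?_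
  rw [mem_closedBall_zero_iff, le_div_iff₀ ht0]
  have h1 := sum_low_add_le_F hρ hγ ht x
  have h2 := mul_le_mul_of_nonneg_right (norm_le_blockSum x) ht0.le
  have h3 : P.F x ≤ a := hx
  linarith

theorem exists_subObj_min (hρ : ∀ i, IsRegularizer (P.rho i) (B i) (τ i))
    (hγ : ∀ i, IsSmoothTerm (P.gamma i) (Lγ i) (low i)) {t : ℝ} (ht0 : 0 < t)
    (ht : ∀ i, t ≤ τ i) {lam : ℝ} (hlam : 0 < lam) (θ : Vec m) :
    ∃ x, ∀ z, P.subObj lam θ x ≤ P.subObj lam θ z := by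
  have hcont := (convexOn_subObj hρ hγ hlam.le θ).locallyLipschitz.continuous
  refine hcont.exists_forall_le_of_isBounded 0
    ((isBounded_F_le hρ hγ ht0 ht (P.subObj lam θ 0 / lam)).subset fun x hx => ?_)
  have hx' : P.subObj lam θ x ≤ P.subObj lam θ 0 := hx
  change P.F x ≤ P.subObj lam θ 0 / lam
  rw [le_div_iff₀ hlam]
  rw [subObj_eq] at hx'
  nlinarith [sq_nonneg ‖P.fullA x - P.b - lam • θ‖]

theorem exists_opt (hρ : ∀ i, IsRegularizer (P.rho i) (B i) (τ i))
    (hγ : ∀ i, IsSmoothTerm (P.gamma i) (Lγ i) (low i)) {t : ℝ} (ht0 : 0 < t)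
    (ht : ∀ i, t ≤ τ i) (hs : Function.Surjective P.fullA) :
    ∃ x, P.fullA x = P.b ∧ P.F x = P.optVal ∧ ∀ z, P.fullA z = P.b → P.optVal ≤ P.F z := by
  obtain ⟨x₀, hx₀⟩ := hs P.b
  have hcl : IsClosed {x | P.fullA x = P.b} :=
    isClosed_eq P.fullACLM.continuous continuous_const
  have hK : IsCompact ({x | P.fullA x = P.b} ∩ {x | P.F x ≤ P.F x₀}) :=
    Metric.isCompact_of_isClosed_isBounded
      (hcl.inter (isClosed_le (continuous_F hρ hγ) continuous_const))
      ((isBounded_F_le hρ hγ ht0 ht _).subset Set.inter_subset_right)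
  obtain ⟨x, ⟨hxA, hxF⟩, hx⟩ := hK.exists_isMinOn ⟨x₀, hx₀, le_refl (P.F x₀)⟩
    (continuous_F hρ hγ).continuousOn
  have hmin : ∀ z, P.fullA z = P.b → P.F x ≤ P.F z := by
    intro z hz
    rcases le_total (P.F z) (P.F x₀) with h | h
    · exact hx ⟨hz, h⟩
    · exact le_trans hxF h
  have : P.F x = P.optVal := by
    have hl : IsLeast (P.F '' {x | P.fullA x = P.b}) (P.F x) :=
      ⟨⟨x, hxA, rfl⟩, by rintro _ ⟨z, hz, rfl⟩; exact hmin z hz⟩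
    exact hl.csInf_eq.symm
  exact ⟨x, hxA, this, fun z hz => this ▸ hmin z hz⟩

/-! ### A bounded right inverse of the full map -/

theorem minSigma_le (i : Fin N) : P.minSigma ≤ sigmaMin (P.A i) :=
  ciInf_le (Set.finite_range _).bddBelow i

theorem minSigma_pos [Nonempty (Fin N)] (h : ∀ i, 0 < sigmaMin (P.A i)) : 0 < P.minSigma := by
  obtain ⟨i, hi⟩ := exists_eq_ciInf_of_finite (f := fun i => sigmaMin (P.A i))
  rw [minSigma, ← hi]
  exact h i

theorem minSigma_le_sigmaMax [Nonempty (Fin N)] : P.minSigma ≤ sigmaMax P.fullA := by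
  obtain ⟨i⟩ := ‹Nonempty (Fin N)›
  refine (minSigma_le i).trans
    (sigmaMin_le_of_forall_norm_apply_le _ (P.fullA.singularValues_nonneg 0) fun v => ?_)
  rw [← P.fullA_single i v]
  refine (norm_apply_le_sigmaMax _ _).trans ?_
  rw [PiLp.norm_single]

/-- If `m ≤ n`, a single block is already onto, and its preimage is padded by zeros. If `n < m`, no
block can be onto, so the full map is inverted and `κ` converts its smallest singular value to
`minSigma`. -/
theorem exists_preimage_minSigma_le [Nonempty (Fin N)] (h : ∀ i, 0 < sigmaMin (P.A i))
    (hs : Function.Surjective P.fullA) {κ M : ℝ}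
    (hκ : n < m → P.minSigma ≤ κ * sigmaMin P.fullA) (hM1 : 1 ≤ M) (hMκ : κ ≤ M) (y : Vec m) :
    ∃ d, P.fullA d = y ∧ P.minSigma * ‖d‖ ≤ M * ‖y‖ := by
  rcases lt_or_ge n m with hnm | hnm
  · have hμ := minSigma_pos h
    have h1 := hκ hnm
    have h2 : P.minSigma ≤ M * sigmaMin P.fullA :=
      h1.trans (mul_le_mul_of_nonneg_right hMκ (sigmaMin_nonneg _))
    have h3 : 0 < sigmaMin P.fullA := by
      rcases (sigmaMin_nonneg P.fullA).lt_or_eq with h3 | h3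
      · exact h3
      · rw [← h3, mul_zero] at h2; linarith
    obtain ⟨d, hd, hd'⟩ := exists_preimage_sigmaMin_le P.fullA
      (LinearMap.finrank_le_finrank_of_surjective hs) h3 y
    refine ⟨d, hd, ?_⟩
    nlinarith [mul_le_mul_of_nonneg_right h2 (norm_nonneg d)]
  · obtain ⟨i⟩ := ‹Nonempty (Fin N)›
    obtain ⟨v, hv, hv'⟩ := exists_preimage_sigmaMin_le (P.A i) (by simpa using hnm) (h i) y
    refine ⟨PiLp.single 2 i v, by rw [fullA_single, hv], ?_⟩
    rw [PiLp.norm_single]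
    nlinarith [mul_le_mul_of_nonneg_right (minSigma_le (P := P) i) (norm_nonneg v), norm_nonneg y]

end Problem

variable {N n m : ℕ}

theorem weightedSq_le_mul_blockSum_sq {L : Fin N → ℝ} {b : ℝ} (hb : 0 ≤ b) (hL : ∀ i, L i ≤ b)
    (d : BlockVec N n) : weightedSq L d ≤ b * blockSum d ^ 2 := by
  have h1 : ∑ i, ‖d i‖ ^ 2 ≤ blockSum d ^ 2 :=
    Finset.sum_sq_le_sq_sum_of_nonneg fun i _ => norm_nonneg _
  refine le_trans ?_ (mul_le_mul_of_nonneg_left h1 hb)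
  rw [weightedSq, Finset.mul_sum]
  exact Finset.sum_le_sum fun i _ => mul_le_mul_of_nonneg_right (hL i) (sq_nonneg _)

/-! ### Comparing an accepted point with competitors -/

namespace Problem

variable {P : Problem N n m} {B τ G Lγ low : Fin N → ℝ}

/-- `x` minimizes the subproblem up to `α + ξ ∑ ‖xᵢ - zᵢ‖`. -/
def ApproxMin (P : Problem N n m) (lam α ξ : ℝ) (θ : Vec m) (x : BlockVec N n) : Prop :=
  ∀ z, P.subObj lam θ x ≤ P.subObj lam θ z + α + ξ * blockSum (x - z)

/-- Test (a) gives the `α` term; under test (b), the subgradient inequalities and Cauchy–Schwarz in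
each block give the `ξ` term. -/
theorem Accept.approxMin (hγ : ∀ i, IsSmoothTerm (P.gamma i) (Lγ i) (low i)) {lam α ξ : ℝ}
    (hlam : 0 ≤ lam) (hα : 0 ≤ α) (hξ : 0 ≤ ξ) {θ : Vec m} {x : BlockVec N n}
    (h : P.Accept lam α ξ θ x) : P.ApproxMin lam α ξ θ x := by
  intro z
  rcases h with h | ⟨q, hq⟩
  · have := h z
    have := mul_nonneg hξ (blockSum_nonneg (x - z))
    linarith
  · have h1 := smoothPart_add_inner_le hγ hlam θ x z
    set g := gradient (P.smoothPart lam θ) x with hg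
    have h2 : ∀ i, lam * P.rho i (x i) ≤ lam * P.rho i (z i) + ⟪g i, (z - x) i⟫_ℝ
        + ξ * ‖(x - z) i‖ := by
      intro i
      obtain ⟨hqi, hgi⟩ := hq i
      have a1 := mul_le_mul_of_nonneg_left (hqi (z i)) hlam
      have a2 : ⟪lam • q i + g i, x i - z i⟫_ℝ ≤ ‖lam • q i + g i‖ * ‖x i - z i‖ :=
        real_inner_le_norm _ _
      have hN : (1 : ℝ) ≤ Real.sqrt N := by
        rw [Real.one_le_sqrt]
        exact_mod_cast Nat.one_le_iff_ne_zero.2 (fun h0 => by subst h0; exact i.elim0)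
      have a3 : ‖lam • q i + g i‖ ≤ ξ := hgi.trans (div_le_self hξ hN)
      have a4 := mul_le_mul_of_nonneg_right a3 (norm_nonneg (x i - z i))
      rw [inner_add_left, real_inner_smul_left] at a2
      have a5 : ⟪q i, z i - x i⟫_ℝ = -⟪q i, x i - z i⟫_ℝ := by rw [← inner_neg_right, neg_sub]
      have a6 : ⟪g i, z i - x i⟫_ℝ = -⟪g i, x i - z i⟫_ℝ := by rw [← inner_neg_right, neg_sub]
      simp only [PiLp.sub_apply]
      rw [a5] at a1
      rw [a6]
      linarith
    have h3 := Finset.sum_le_sum fun i (_ : i ∈ Finset.univ) => h2 i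
    simp only [Finset.sum_add_distrib, ← Finset.mul_sum] at h3
    have h4 : ⟪g, z - x⟫_ℝ = ∑ i, ⟪g i, (z - x) i⟫_ℝ := PiLp.inner_apply g (z - x)
    simp only [subObj, rhoBar, blockSum]
    linarith

/-- At a feasible point the penalty is `‖λθ‖²/2`, at `x` it is `‖λθ'‖²/2`; divide by `λ`. -/
theorem ApproxMin.value_le {lam α ξ : ℝ} (hlam : 0 < lam) (hξ : 0 ≤ ξ) {θ θ' : Vec m}
    {x xs : BlockVec N n} (h : P.ApproxMin lam α ξ θ x)
    (hθ' : P.fullA x - P.b - lam • θ = -(lam • θ')) (hxs : P.fullA xs = P.b) :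
    P.F x - P.F xs + lam / 2 * ‖θ'‖ ^ 2
      ≤ lam / 2 * ‖θ‖ ^ 2 + α / lam + ξ / lam * (blockSum x + blockSum xs) := by
  have h1 := h xs
  rw [subObj_eq, subObj_eq, hθ', hxs, sub_self, zero_sub, norm_neg, norm_neg, norm_smul, norm_smul,
    Real.norm_of_nonneg hlam.le] at h1
  have h2 := mul_le_mul_of_nonneg_left (blockSum_sub_le x xs) hξ
  have e : lam * (lam / 2 * ‖θ‖ ^ 2 + α / lam + ξ / lam * (blockSum x + blockSum xs))
      = lam ^ 2 / 2 * ‖θ‖ ^ 2 + α + ξ * (blockSum x + blockSum xs) := by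
    field_simp
  refine le_of_mul_le_mul_left ?_ hlam
  rw [e]
  nlinarith

/-- Of the coercivity `δ + η`, the part `η` absorbs the inexactness at `x`. One `D` pays for the
optimal value, the other for `η * blockSum xs`. -/
theorem ApproxMin.mul_blockSum_le (hρ : ∀ i, IsRegularizer (P.rho i) (B i) (τ i))
    (hγ : ∀ i, IsSmoothTerm (P.gamma i) (Lγ i) (low i)) {δ η D a : ℝ} (hδ : 0 ≤ δ)
    (hτ : ∀ i, δ + η ≤ τ i) {lam α ξ : ℝ} (hlam : 0 < lam) (hξ : 0 ≤ ξ) (hα : α ≤ a * lam)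
    (hξη : ξ ≤ η * lam) {θ θ' : Vec m} {x xs : BlockVec N n} (h : P.ApproxMin lam α ξ θ x)
    (hθ' : P.fullA x - P.b - lam • θ = -(lam • θ')) (hxs : P.fullA xs = P.b)
    (hD : P.F xs - ∑ i, low i ≤ D) :
    δ * blockSum x + lam / 2 * ‖θ'‖ ^ 2 ≤ 2 * D + a + lam / 2 * ‖θ‖ ^ 2 := by
  have h1 := h.value_le hlam hξ hθ' hxs
  have h2 := sum_low_add_le_F hρ hγ hτ x
  have h3 := sum_low_add_le_F hρ hγ hτ xs
  have h4 : α / lam ≤ a := (div_le_iff₀ hlam).2 hα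
  have h5 : ξ / lam ≤ η := (div_le_iff₀ hlam).2 hξη
  have h6 := mul_le_mul_of_nonneg_right h5 (add_nonneg (blockSum_nonneg x) (blockSum_nonneg xs))
  have h7 := mul_nonneg hδ (blockSum_nonneg xs)
  nlinarith

/-- Moving by `lam • d` cancels the residual exactly, at a cost in `F` of order `lam`; every term
then scales as `lam ^ 2`. -/
theorem ApproxMin.norm_sq_le (hρ : ∀ i, IsRegularizer (P.rho i) (B i) (τ i))
    (hγ : ∀ i, IsSmoothTerm (P.gamma i) (Lγ i) (low i))
    (hG : ∀ i x, ‖gradient (P.gamma i) x‖ ≤ G i) {b : ℝ} (hb : ∀ i, B i + G i ≤ b)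
    {lam α ξ a η : ℝ} (hlam : 0 < lam) (hα : α ≤ a * lam ^ 2) (hξ : ξ ≤ η * lam)
    {θ θ' : Vec m} {x d : BlockVec N n} (h : P.ApproxMin lam α ξ θ x)
    (hθ' : P.fullA x - P.b - lam • θ = -(lam • θ')) (hd : P.fullA d = θ') :
    1 / 2 * ‖θ'‖ ^ 2 ≤ a + (η + b) * blockSum d := by
  have h1 := h (x + lam • d)
  have e1 : P.fullA (x + lam • d) - P.b - lam • θ = 0 := by
    rw [map_add, map_smul, hd]
    have : P.fullA x + lam • θ' - P.b - lam • θ = (P.fullA x - P.b - lam • θ) + lam • θ' := by abel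
    rw [this, hθ', neg_add_cancel]
  have e2 : blockSum (lam • d) = lam * blockSum d := by
    simp only [blockSum, PiLp.smul_apply, norm_smul, Real.norm_of_nonneg hlam.le, Finset.mul_sum]
  have e3 : blockSum (x - (x + lam • d)) = lam * blockSum d := by
    rw [← e2]
    simp [blockSum]
  rw [subObj_eq, subObj_eq, hθ', e1, e3, norm_neg, norm_smul, Real.norm_of_nonneg hlam.le,
    norm_zero] at h1
  have h2 := mul_le_mul_of_nonneg_left (F_sub_le hρ hγ hG hb x (lam • d)) hlam.le
  rw [e2] at h2
  have h3 := mul_le_mul_of_nonneg_right hξ (mul_nonneg hlam.le (blockSum_nonneg d))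
  refine le_of_mul_le_mul_left ?_ (pow_pos hlam 2)
  nlinarith

end Problem

/-- The assumptions on the problem and on the parameters, with `δ` a margin in
`ξ1 / lam1 < τ i`, `b` a Lipschitz constant of the blocks of the objective, `Λ` a bound for the
`Lγ i`, and `M` the constant of a bounded right inverse of `A` relative to `minSigma`. -/
structure Setting (P : Problem N n m) (B τ G Lγ low : Fin N → ℝ)
    (lam1 α1 ξ1 D s δ b Λ M : ℝ) : Prop where
  nonempty : Nonempty (Fin N)
  lam1_pos : 0 < lam1
  α1_pos : 0 < α1
  ξ1_pos : 0 < ξ1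
  s_pos : 0 < s
  δ_pos : 0 < δ
  δ_le : ∀ i, δ + ξ1 / lam1 ≤ τ i
  b_ge : ∀ i, B i + G i ≤ b
  b_nonneg : 0 ≤ b
  Λ_ge : ∀ i, Lγ i ≤ Λ
  Λ_nonneg : 0 ≤ Λ
  Lγ_nonneg : ∀ i, 0 ≤ Lγ i
  M_nonneg : 0 ≤ M
  D_nonneg : 0 ≤ D
  rho : ∀ i, IsRegularizer (P.rho i) (B i) (τ i)
  gamma : ∀ i, IsSmoothTerm (P.gamma i) (Lγ i) (low i)
  grad : ∀ i x, ‖gradient (P.gamma i) x‖ ≤ G i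
  surj : Function.Surjective P.fullA
  minSigma_pos : 0 < P.minSigma
  s_le : s ≤ sigmaMax P.fullA
  preimage : ∀ y, ∃ d, P.fullA d = y ∧ P.minSigma * ‖d‖ ≤ M * ‖y‖
  gap : P.optVal - ∑ i, low i ≤ D

/-- Bound for `λ ‖θ‖²`. -/
def dualEnergy (c lam1 α1 D : ℝ) : ℝ := 2 * (2 * D + α1 / lam1) / (1 - c)

/-- Bound for the sum of the block norms of the iterates and of the subproblem minimizers. -/
def radius (N : ℕ) (c lam1 α1 D δ : ℝ) : ℝ :=
  (2 * D + α1 / lam1 + dualEnergy c lam1 α1 D / 2) / δ + N * D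

/-- The constant `T` in `‖θ‖ ≤ T Θ`. -/
def dualConst (N : ℕ) (lam1 α1 ξ1 s b M : ℝ) : ℝ :=
  2 * ((ξ1 / lam1 + b) * (N * M / s)) + 2 * (α1 / lam1 ^ 2) + 1

/-- The constant `O` in `|F x - F*| ≤ O Θ² λ`. -/
def optConst (N : ℕ) (c lam1 α1 ξ1 D s δ b M : ℝ) : ℝ :=
  dualConst N lam1 α1 ξ1 s b M ^ 2 / 2 + α1 / lam1 ^ 2
    + 2 * (ξ1 / lam1 ^ 2) * radius N c lam1 α1 D δ
    + 2 * dualConst N lam1 α1 ξ1 s b M * b * (N * M / s)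

/-- The constant `E` in `N^(k) ≤ E σ_max(A) / λ^(k)`. -/
def countConst (N : ℕ) (c lam1 α1 D s δ Λ : ℝ) : ℝ :=
  8 * (lam1 * Λ / s ^ 2 + 1) * radius N c lam1 α1 D δ ^ 2 / (α1 / lam1 ^ 2) + 1 + 2 * lam1 / s

/-- The bounds that hold for all outer iterates. -/
structure Controlled (P : Problem N n m) (lam1 α1 ξ1 V R T : ℝ) (s : State N n m) : Prop where
  lam_pos : 0 < s.lam
  lam_le : s.lam ≤ lam1
  α_eq : s.α = α1 / lam1 ^ 2 * s.lam ^ 2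
  ξ_eq : s.ξ = ξ1 / lam1 ^ 2 * s.lam ^ 2
  energy_le : s.lam * ‖s.θ‖ ^ 2 ≤ V
  θ_le : ‖s.θ‖ ≤ T * P.Theta
  x_le : blockSum s.x ≤ R

theorem Problem.residual_eq (P : Problem N n m) {lam : ℝ} (hlam : lam ≠ 0) (θ : Vec m)
    (x : BlockVec N n) :
    P.fullA x - P.b - lam • θ = -(lam • (θ - (1 / lam) • (P.fullA x - P.b))) := by
  rw [smul_sub, smul_smul, mul_one_div_cancel hlam, one_smul]
  abel

/-! ### Uniform bounds along the outer iteration -/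

namespace Setting

variable {P : Problem N n m} {B τ G Lγ low : Fin N → ℝ} {c lam1 α1 ξ1 D s δ b Λ M : ℝ}

theorem sigmaMax_pos (S : Setting P B τ G Lγ low lam1 α1 ξ1 D s δ b Λ M) :
    0 < sigmaMax P.fullA := S.s_pos.trans_le S.s_le

theorem one_le_Theta (S : Setting P B τ G Lγ low lam1 α1 ξ1 D s δ b Λ M) : 1 ≤ P.Theta := by
  have := S.nonempty
  rw [Problem.Theta, one_le_div S.minSigma_pos]
  exact Problem.minSigma_le_sigmaMax

/-- The factor `σ_max(A) / s ≥ 1` replaces `1 / minSigma` by `Theta / s`. -/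
theorem exists_preimage (S : Setting P B τ G Lγ low lam1 α1 ξ1 D s δ b Λ M) (y : Vec m) :
    ∃ d, P.fullA d = y ∧ blockSum d ≤ N * M / s * P.Theta * ‖y‖ := by
  obtain ⟨d, hd, hd'⟩ := S.preimage y
  refine ⟨d, hd, (blockSum_le d).trans ?_⟩
  have hμ := S.minSigma_pos
  have h1 : ‖d‖ ≤ M * ‖y‖ / P.minSigma := by
    rw [le_div_iff₀ hμ, mul_comm]; exact hd'
  have h2 : (1 : ℝ) ≤ sigmaMax P.fullA / s := (one_le_div S.s_pos).2 S.s_le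
  have h3 : (0 : ℝ) ≤ N * (M * ‖y‖ / P.minSigma) :=
    mul_nonneg (Nat.cast_nonneg _) (div_nonneg (mul_nonneg S.M_nonneg (norm_nonneg _)) hμ.le)
  have h4 := mul_le_mul_of_nonneg_left h1 (Nat.cast_nonneg (α := ℝ) N)
  have h5 := mul_le_mul_of_nonneg_left h2 h3
  have e : (N : ℝ) * (M * ‖y‖ / P.minSigma) * (sigmaMax P.fullA / s)
      = N * M / s * P.Theta * ‖y‖ := by rw [Problem.Theta]; ring
  linarith

theorem dualEnergy_nonneg (S : Setting P B τ G Lγ low lam1 α1 ξ1 D s δ b Λ M) (hc1 : c < 1) :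
    0 ≤ dualEnergy c lam1 α1 D := by
  have := S.D_nonneg
  have := S.α1_pos
  have := S.lam1_pos
  have : 0 < 1 - c := by linarith
  unfold dualEnergy
  positivity

theorem radius_ge (S : Setting P B τ G Lγ low lam1 α1 ξ1 D s δ b Λ M) (hc1 : c < 1) :
    2 * D + α1 / lam1 + dualEnergy c lam1 α1 D / 2
    ≤ δ * radius N c lam1 α1 D δ ∧ N * D ≤ radius N c lam1 α1 D δ ∧
    0 ≤ radius N c lam1 α1 D δ := by
  have h1 := S.D_nonneg
  have h2 := S.α1_pos
  have h3 := S.lam1_pos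
  have h4 := S.δ_pos
  have h5 := S.dualEnergy_nonneg hc1
  have h6 : 0 ≤ (N : ℝ) * D := by positivity
  unfold radius
  refine ⟨?_, le_add_of_nonneg_left (by positivity), by positivity⟩
  rw [mul_add, mul_div_cancel₀ _ h4.ne']
  nlinarith

theorem dualConst_ge (S : Setting P B τ G Lγ low lam1 α1 ξ1 D s δ b Λ M) :
    2 * ((ξ1 / lam1 + b) * (N * M / s)) + 2 * (α1 / lam1 ^ 2) + 1
    ≤ dualConst N lam1 α1 ξ1 s b M ∧ 0 ≤ (ξ1 / lam1 + b) * (N * M / s) ∧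
    0 ≤ N * M / s ∧ 1 ≤ dualConst N lam1 α1 ξ1 s b M := by
  have h1 := S.ξ1_pos
  have h2 := S.α1_pos
  have h3 := S.lam1_pos
  have h4 := S.s_pos
  have h5 := S.b_nonneg
  have h6 := S.M_nonneg
  refine ⟨le_refl _, by positivity, by positivity, ?_⟩
  unfold dualConst
  have : 0 ≤ 2 * ((ξ1 / lam1 + b) * (N * M / s)) + 2 * (α1 / lam1 ^ 2) := by positivity
  linarith

theorem exists_opt (S : Setting P B τ G Lγ low lam1 α1 ξ1 D s δ b Λ M) :
    ∃ x, P.fullA x = P.b ∧ P.F x = P.optVal ∧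
    ∀ z, P.fullA z = P.b → P.optVal ≤ P.F z :=
  Problem.exists_opt S.rho S.gamma (t := δ + ξ1 / lam1)
    (add_pos S.δ_pos (div_pos S.ξ1_pos S.lam1_pos)) S.δ_le S.surj

section Step

variable {V T : ℝ} {st : State N n m}

theorem blockSum_le_radius (S : Setting P B τ G Lγ low lam1 α1 ξ1 D s δ b Λ M) (hc1 : c < 1)
    {lam α ξ : ℝ} (hlam : 0 < lam) (hξ : 0 ≤ ξ) (hα : α ≤ α1 / lam1 * lam)
    (hξη : ξ ≤ ξ1 / lam1 * lam) {θ : Vec m} (hθ : lam * ‖θ‖ ^ 2 ≤ dualEnergy c lam1 α1 D)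
    {x : BlockVec N n} (h : P.ApproxMin lam α ξ θ x) :
    blockSum x ≤ radius N c lam1 α1 D δ ∧
      lam * ‖θ - (1 / lam) • (P.fullA x - P.b)‖ ^ 2
        ≤ 2 * (2 * D + α1 / lam1) + dualEnergy c lam1 α1 D := by
  obtain ⟨xs, hxs, hF, -⟩ := S.exists_opt
  have h1 := h.mul_blockSum_le S.rho S.gamma S.δ_pos.le S.δ_le hlam hξ hα hξη
    (P.residual_eq hlam.ne' θ x) hxs (hF ▸ S.gap)
  have h2 := S.radius_ge hc1
  have h3 := mul_nonneg S.δ_pos.le (blockSum_nonneg x)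
  have h4 := mul_nonneg hlam.le (sq_nonneg ‖θ - (1 / lam) • (P.fullA x - P.b)‖)
  refine ⟨le_of_mul_le_mul_left ?_ S.δ_pos, ?_⟩
  · linarith
  · linarith

theorem norm_dual_le (S : Setting P B τ G Lγ low lam1 α1 ξ1 D s δ b Λ M)
    {lam α ξ : ℝ} (hlam : 0 < lam) (hα : α ≤ α1 / lam1 ^ 2 * lam ^ 2)
    (hξη : ξ ≤ ξ1 / lam1 * lam) {θ : Vec m} {x : BlockVec N n} (h : P.ApproxMin lam α ξ θ x) :
    ‖θ - (1 / lam) • (P.fullA x - P.b)‖ ≤ dualConst N lam1 α1 ξ1 s b M * P.Theta := by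
  set θ' := θ - (1 / lam) • (P.fullA x - P.b) with hθ'
  obtain ⟨d, hd, hd'⟩ := S.exists_preimage θ'
  have h1 := h.norm_sq_le S.rho S.gamma S.grad S.b_ge hlam hα hξη
    (P.residual_eq hlam.ne' θ x) hd
  have hηb : 0 ≤ ξ1 / lam1 + b := add_nonneg (div_pos S.ξ1_pos S.lam1_pos).le S.b_nonneg
  have h2 := mul_le_mul_of_nonneg_left hd' hηb
  obtain ⟨h3, h4, -, h5⟩ := S.dualConst_ge
  have hΘ := S.one_le_Theta
  set W := (ξ1 / lam1 + b) * (N * M / s) with hW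
  set u := ‖θ'‖ with hu
  have hα2 : 0 ≤ α1 / lam1 ^ 2 := div_nonneg S.α1_pos.le (sq_nonneg _)
  have h6 : 1 / 2 * u ^ 2 ≤ α1 / lam1 ^ 2 + W * P.Theta * u := by
    refine h1.trans (add_le_add_right (h2.trans (le_of_eq ?_)) _)
    rw [hW]; ring
  -- If `u` exceeded the bound, then `u ≥ 1`, so the constant term is at most a multiple of `Theta *
  -- u` and the quadratic inequality fails.
  by_contra hlt
  push Not at hlt
  have h7 : (2 * W + 2 * (α1 / lam1 ^ 2) + 1) * P.Theta < u :=
    lt_of_le_of_lt (mul_le_mul_of_nonneg_right h3 (by linarith)) hlt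
  have h8 : 1 ≤ u := by nlinarith
  have h9 := mul_lt_mul_of_pos_right h7 (by linarith : 0 < u)
  have h10 : α1 / lam1 ^ 2 ≤ α1 / lam1 ^ 2 * (P.Theta * u) :=
    le_mul_of_one_le_right hα2 (one_le_mul_of_one_le_of_one_le hΘ h8)
  nlinarith

theorem count_le (S : Setting P B τ G Lγ low lam1 α1 ξ1 D s δ b Λ M) (hc1 : c < 1)
    (hst : Controlled P lam1 α1 ξ1 (dualEnergy c lam1 α1 D) (radius N c lam1 α1 D δ) T st) :
    (P.acceptedCounts Lγ st).Nonempty ∧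
      (P.innerCount Lγ st : ℝ)
        ≤ countConst N c lam1 α1 D s δ Λ * sigmaMax P.fullA / st.lam := by
  have hlam := hst.lam_pos
  have hl1 := S.lam1_pos
  have hσ := S.sigmaMax_pos
  have hs := S.s_pos
  have hΛ := S.Λ_nonneg
  have ha2 : 0 < α1 / lam1 ^ 2 := div_pos S.α1_pos (pow_pos hl1 2)
  obtain ⟨-, -, hR⟩ := S.radius_ge hc1
  set R := radius N c lam1 α1 D δ
  set a2 := α1 / lam1 ^ 2
  set σ := sigmaMax P.fullA with hσdef
  set H := lam1 * Λ / s ^ 2 + 1 with hH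
  set X := 8 * H * R ^ 2 / a2 with hX
  have hH1 : 0 ≤ H := by positivity
  have hX0 : 0 ≤ X := by positivity
  -- With `L i ≤ H σ²` and both points of block sum at most `R`, it is enough that `(ℓ + 1)² ≥ X σ²
  -- / λ²`. Using `X + 1` avoids a square root.
  set q := (X + 1) * σ / st.lam with hq
  have hq0 : 0 ≤ q := by positivity
  obtain ⟨z, hz⟩ := Problem.exists_subObj_min S.rho S.gamma (t := δ + ξ1 / lam1)
    (add_pos S.δ_pos (div_pos S.ξ1_pos hl1)) S.δ_le hlam st.θ
  -- The exact minimizer satisfies the iterates' bound, with `α = ξ = 0`.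
  have hzR : blockSum z ≤ R := by
    refine (S.blockSum_le_radius hc1 hlam le_rfl (α := 0) ?_ ?_ hst.energy_le
      (x := z) (fun y => by simpa using hz y)).1
    · have := S.α1_pos; positivity
    · have := S.ξ1_pos; positivity
  set L : Fin N → ℝ := fun i => st.lam * Lγ i + σ ^ 2 with hL
  have hLpos : ∀ i, 0 < L i := fun i => by
    have := S.Lγ_nonneg i
    positivity
  have hLle : ∀ i, L i ≤ H * σ ^ 2 := by
    intro i
    have h1 : st.lam * Lγ i ≤ lam1 * Λ :=
      mul_le_mul hst.lam_le (S.Λ_ge i) (S.Lγ_nonneg i) hl1.le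
    have h2 : s ^ 2 ≤ σ ^ 2 := pow_le_pow_left₀ hs.le S.s_le 2
    have h3 : lam1 * Λ ≤ lam1 * Λ / s ^ 2 * σ ^ 2 := by
      rw [div_mul_eq_mul_div, le_div_iff₀ (by positivity)]
      exact mul_le_mul_of_nonneg_left h2 (by positivity)
    simp only [hL, hH]
    linarith
  have hconv : ∀ i, ConvexOn ℝ Set.univ fun v => st.lam * P.rho i v := fun i => by
    simpa using (S.rho i).convex.smul hlam.le
  have hnonneg : ∀ i v, 0 ≤ st.lam * P.rho i v := fun i v =>
    mul_nonneg hlam.le ((mul_nonneg (S.rho i).tau_pos.le (norm_nonneg _)).trans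
      ((S.rho i).coercive v))
  have hobj : ∀ x : BlockVec N n, ∑ i, st.lam * P.rho i (x i) + P.smoothPart st.lam st.θ x
      = P.subObj st.lam st.θ x := fun x => by
    rw [Problem.subObj, Problem.rhoBar, Finset.mul_sum]
  have hmem : ⌈q⌉₊ + 1 ∈ P.acceptedCounts Lγ st := by
    refine ⟨Nat.le_add_left 1 _, Or.inl fun w => ?_⟩
    have h1 := apg_le hLpos hconv hnonneg
      ((Problem.convexOn_subObj S.rho S.gamma hlam.le st.θ).congr fun x _ => (hobj x).symm)
      (Problem.smoothPart_add_inner_le S.gamma hlam.le st.θ)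
      (Problem.smoothPart_le_add S.gamma hlam.le st.θ) st.x z (Nat.le_add_left 1 ⌈q⌉₊)
    rw [hobj, hobj] at h1
    change _ * (P.subObj st.lam st.θ (P.innerIterate Lγ st (⌈q⌉₊ + 1)) - _) ≤ _ at h1
    have h2 := weightedSq_le_mul_blockSum_sq (by positivity) hLle (z - st.x)
    have h3 : blockSum (z - st.x) ≤ 2 * R := by
      linarith [blockSum_sub_le z st.x, hst.x_le]
    have h4 : blockSum (z - st.x) ^ 2 ≤ (2 * R) ^ 2 :=
      pow_le_pow_left₀ (blockSum_nonneg _) h3 2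
    have h5 := mul_le_mul_of_nonneg_left h4 (by positivity : 0 ≤ H * σ ^ 2)
    have h6 : q ≤ ((⌈q⌉₊ + 1 : ℕ) : ℝ) + 1 := by
      push_cast
      linarith [Nat.le_ceil q]
    have h7 : q ^ 2 ≤ (((⌈q⌉₊ + 1 : ℕ) : ℝ) + 1) ^ 2 := pow_le_pow_left₀ hq0 h6 2
    have h8 : 8 * H * σ ^ 2 * R ^ 2 ≤ q ^ 2 * st.α := by
      have e1 : q ^ 2 * st.α = (X + 1) ^ 2 * σ ^ 2 * a2 := by
        rw [hst.α_eq, show α1 / lam1 ^ 2 = a2 from rfl, hq]; field_simp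
      have e2 : 8 * H * σ ^ 2 * R ^ 2 = X * a2 * σ ^ 2 := by
        rw [hX, div_mul_cancel₀ _ ha2.ne']; ring
      rw [e1, e2]
      have : X ≤ (X + 1) ^ 2 := by nlinarith
      nlinarith [mul_le_mul_of_nonneg_right this (by positivity : 0 ≤ a2 * σ ^ 2)]
    have hα : 0 ≤ st.α := by rw [hst.α_eq]; positivity
    have h9 := mul_le_mul_of_nonneg_right h7 hα
    have h10 : 0 < (((⌈q⌉₊ + 1 : ℕ) : ℝ) + 1) ^ 2 := by positivity
    have h11 : P.subObj st.lam st.θ (P.innerIterate Lγ st (⌈q⌉₊ + 1)) - P.subObj st.lam st.θ z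
        ≤ st.α := by
      refine le_of_mul_le_mul_left (h1.trans ?_) h10
      nlinarith
    linarith [hz w]
  refine ⟨⟨_, hmem⟩, ?_⟩
  have h1 : (P.innerCount Lγ st : ℝ) ≤ ((⌈q⌉₊ + 1 : ℕ) : ℝ) := by
    exact_mod_cast Nat.sInf_le hmem
  have h2 := Nat.ceil_lt_add_one hq0
  -- This term of `countConst` pays for the ceiling and the extra iteration.
  have h3 : 2 ≤ 2 * lam1 / s * σ / st.lam := by
    rw [le_div_iff₀ hlam, div_mul_eq_mul_div, le_div_iff₀ hs]
    nlinarith [mul_le_mul hst.lam_le S.s_le hs.le hl1.le]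
  have e : countConst N c lam1 α1 D s δ Λ * σ / st.lam = q + 2 * lam1 / s * σ / st.lam := by
    simp only [countConst, hq, hX, hH, R, a2]; ring
  rw [e]
  push_cast at h1
  linarith

theorem step (S : Setting P B τ G Lγ low lam1 α1 ξ1 D s δ b Λ M) (hc0 : 0 < c) (hc1 : c < 1)
    (hst : Controlled P lam1 α1 ξ1 (dualEnergy c lam1 α1 D) (radius N c lam1 α1 D δ)
      (dualConst N lam1 α1 ξ1 s b M) st) :
    Controlled P lam1 α1 ξ1 (dualEnergy c lam1 α1 D) (radius N c lam1 α1 D δ)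
      (dualConst N lam1 α1 ξ1 s b M) (P.dfalStep Lγ c st) ∧
    ‖P.fullA (P.dfalStep Lγ c st).x - P.b‖
      ≤ 2 * dualConst N lam1 α1 ξ1 s b M * P.Theta * st.lam ∧
    |P.F (P.dfalStep Lγ c st).x - P.optVal|
      ≤ optConst N c lam1 α1 ξ1 D s δ b M * P.Theta ^ 2 * st.lam := by
  have hlam := hst.lam_pos
  have hl1 := S.lam1_pos
  have hα1 := S.α1_pos
  have hξ1 := S.ξ1_pos
  have hα0 : 0 ≤ st.α := by rw [hst.α_eq]; positivity
  have hξ0 : 0 ≤ st.ξ := by rw [hst.ξ_eq]; positivity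
  have hacc : P.Accept st.lam st.α st.ξ st.θ (P.dfalStep Lγ c st).x :=
    (Nat.sInf_mem (S.count_le hc1 hst).1).2
  have happ := hacc.approxMin S.gamma hlam.le hα0 hξ0
  have hθ' : (P.dfalStep Lγ c st).θ
      = st.θ - (1 / st.lam) • (P.fullA (P.dfalStep Lγ c st).x - P.b) := rfl
  have hscale : ∀ a : ℝ, 0 ≤ a → a / lam1 ^ 2 * st.lam ^ 2 ≤ a / lam1 * st.lam := by
    intro a ha
    have e : a / lam1 ^ 2 * st.lam ^ 2 = a / lam1 * st.lam * (st.lam / lam1) := by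
      field_simp
    rw [e]
    exact mul_le_of_le_one_right (by positivity) ((div_le_one hl1).2 hst.lam_le)
  have hα : st.α ≤ α1 / lam1 * st.lam := hst.α_eq ▸ hscale α1 hα1.le
  have hξ : st.ξ ≤ ξ1 / lam1 * st.lam := hst.ξ_eq ▸ hscale ξ1 hξ1.le
  have hB := S.blockSum_le_radius hc1 hlam hξ0 hα hξ hst.energy_le happ
  have hT := S.norm_dual_le hlam hst.α_eq.le hξ happ
  rw [← hθ'] at hB hT
  set x' := (P.dfalStep Lγ c st).x with hx'
  set θ' := (P.dfalStep Lγ c st).θ with hθdef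
  obtain ⟨-, -, hW0, hT1⟩ := S.dualConst_ge
  set T := dualConst N lam1 α1 ξ1 s b M with hTdef
  set R := radius N c lam1 α1 D δ with hRdef
  have hΘ := S.one_le_Theta
  have hres : P.fullA x' - P.b = st.lam • (st.θ - θ') := by
    rw [hθ', sub_sub_cancel, smul_smul, mul_one_div_cancel hlam.ne', one_smul]
  have hfeas : ‖P.fullA x' - P.b‖ ≤ 2 * T * P.Theta * st.lam := by
    rw [hres, norm_smul, Real.norm_of_nonneg hlam.le]
    have : ‖st.θ - θ'‖ ≤ 2 * T * P.Theta := by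
      linarith [norm_sub_le st.θ θ', hst.θ_le]
    nlinarith
  have hlam' : (P.dfalStep Lγ c st).lam = c * st.lam := rfl
  refine ⟨⟨?_, ?_, ?_, ?_, ?_, hT, hB.1⟩, hfeas, ?_⟩
  · rw [hlam']; positivity
  · rw [hlam']; nlinarith [hst.lam_le]
  · change c ^ 2 * st.α = _ * (c * st.lam) ^ 2
    rw [hst.α_eq]; ring
  · change c ^ 2 * st.ξ = _ * (c * st.lam) ^ 2
    rw [hst.ξ_eq]; ring
  -- With `V = dualEnergy`, the new energy is at most `c ((1 - c) V + V) = c (2 - c) V ≤ V`.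
  · rw [hlam', mul_assoc]
    refine (mul_le_mul_of_nonneg_left hB.2 hc0.le).trans ?_
    have h1c : (1 - c) ≠ 0 := by linarith
    have e : dualEnergy c lam1 α1 D * (1 - c) = 2 * (2 * D + α1 / lam1) :=
      div_mul_cancel₀ _ h1c
    have h2 : 0 ≤ 2 * (2 * D + α1 / lam1) := by
      have := S.D_nonneg
      positivity
    nlinarith
  · obtain ⟨xs, hxs, hF, hopt⟩ := S.exists_opt
    obtain ⟨hR1, -, hR0⟩ := S.radius_ge hc1
    have hup := happ.value_le hlam hξ0 (P.residual_eq hlam.ne' st.θ x') hxs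
    have hxsR : blockSum xs ≤ R := by
      have h1 := Problem.sum_low_add_le_F S.rho S.gamma S.δ_le xs
      have h2 := S.gap
      have h3 := S.dualEnergy_nonneg hc1
      have h4 := S.D_nonneg
      have h5 : 0 < ξ1 / lam1 := by positivity
      have h6 := mul_nonneg h5.le (blockSum_nonneg xs)
      have h7 : 0 < α1 / lam1 := by positivity
      refine le_of_mul_le_mul_left ?_ S.δ_pos
      rw [hF] at h1
      linarith
    have e1 : st.α / st.lam = α1 / lam1 ^ 2 * st.lam := by rw [hst.α_eq]; field_simp
    have e2 : st.ξ / st.lam = ξ1 / lam1 ^ 2 * st.lam := by rw [hst.ξ_eq]; field_simp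
    rw [e1, e2, hF] at hup
    have hθsq : ‖st.θ‖ ^ 2 ≤ T ^ 2 * P.Theta ^ 2 := by
      rw [← mul_pow]; exact pow_le_pow_left₀ (norm_nonneg _) hst.θ_le 2
    have hΘ2 : 1 ≤ P.Theta ^ 2 := one_le_pow₀ hΘ
    have hq1 : 0 ≤ α1 / lam1 ^ 2 * st.lam := by positivity
    have hq2 : 0 ≤ ξ1 / lam1 ^ 2 * st.lam := by positivity
    have hb := S.b_nonneg
    have hE : 0 ≤ 2 * T * b * (N * M / s) * P.Theta ^ 2 * st.lam := by positivity
    have hE2 : 0 ≤ (T ^ 2 / 2 + α1 / lam1 ^ 2 + 2 * (ξ1 / lam1 ^ 2) * R) * P.Theta ^ 2 * st.lam := by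
      positivity
    have eO : optConst N c lam1 α1 ξ1 D s δ b M * P.Theta ^ 2 * st.lam
        = (T ^ 2 / 2 + α1 / lam1 ^ 2 + 2 * (ξ1 / lam1 ^ 2) * R) * P.Theta ^ 2 * st.lam
          + 2 * T * b * (N * M / s) * P.Theta ^ 2 * st.lam := by
      simp only [optConst, hTdef, hRdef]; ring
    rw [eO, abs_le]
    constructor
    -- Lower bound: correct `x'` to a feasible point. The right inverse and the residual each
    -- contribute a factor `Theta`.
    · obtain ⟨d, hd, hd'⟩ := S.exists_preimage (P.b - P.fullA x')
      have h1 := hopt (x' + d) (by rw [map_add, hd]; abel)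
      have h2 := Problem.F_sub_le S.rho S.gamma S.grad S.b_ge x' d
      rw [norm_sub_rev] at hd'
      have h3 := hd'.trans (mul_le_mul_of_nonneg_left hfeas (by positivity))
      have h4 := mul_le_mul_of_nonneg_left h3 hb
      have e3 : b * (N * M / s * P.Theta * (2 * T * P.Theta * st.lam))
          = 2 * T * b * (N * M / s) * P.Theta ^ 2 * st.lam := by ring
      linarith
    -- Upper bound: comparison with the constrained minimizer, where `λ‖θ‖²/2` gives the `Theta ^ 2`
    -- and the remaining terms only need `Theta ≥ 1`.
    · have h1 := mul_le_mul_of_nonneg_left hθsq (by positivity : 0 ≤ st.lam / 2)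
      have h2 := mul_le_mul_of_nonneg_left (add_le_add hB.1 hxsR) hq2
      have h3 : 0 ≤ st.lam / 2 * ‖st.θ - (1 / st.lam) • (P.fullA x' - P.b)‖ ^ 2 := by positivity
      have h4 := le_mul_of_one_le_right hq1 hΘ2
      have h5 := le_mul_of_one_le_right (mul_nonneg hq2 (add_nonneg hR0 hR0)) hΘ2
      linarith

theorem controlled_dfal (S : Setting P B τ G Lγ low lam1 α1 ξ1 D s δ b Λ M) (hc0 : 0 < c)
    (hc1 : c < 1) {x0 : BlockVec N n} (hx0 : ‖x0‖ ≤ D) (k : ℕ) :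
    Controlled P lam1 α1 ξ1 (dualEnergy c lam1 α1 D) (radius N c lam1 α1 D δ)
      (dualConst N lam1 α1 ξ1 s b M) (P.dfal Lγ c lam1 α1 ξ1 x0 k) := by
  induction k with
  | zero =>
    have hl1 := S.lam1_pos
    have hΘ := S.one_le_Theta
    have hT := S.dualConst_ge.2.2.2
    refine ⟨hl1, le_rfl, ?_, ?_, ?_, ?_, ?_⟩
    · exact (div_mul_cancel₀ _ (pow_pos hl1 2).ne').symm
    · exact (div_mul_cancel₀ _ (pow_pos hl1 2).ne').symm
    · simpa [Problem.dfal] using S.dualEnergy_nonneg hc1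
    · simp only [Problem.dfal, norm_zero]
      nlinarith
    · exact ((blockSum_le x0).trans (mul_le_mul_of_nonneg_left hx0 (Nat.cast_nonneg _))).trans
        (S.radius_ge hc1).2.1
  | succ k ih => exact (S.step hc0 hc1 ih).1

end Step

theorem constants_nonneg (S : Setting P B τ G Lγ low lam1 α1 ξ1 D s δ b Λ M) (hc1 : c < 1) :
    0 ≤ countConst N c lam1 α1 D s δ Λ ∧ 0 ≤ optConst N c lam1 α1 ξ1 D s δ b M ∧
      0 ≤ dualConst N lam1 α1 ξ1 s b M := by
  have h1 := S.lam1_pos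
  have h2 := S.α1_pos
  have h3 := S.ξ1_pos
  have h4 := S.s_pos
  have h5 := S.Λ_nonneg
  have h6 := S.b_nonneg
  have h7 := S.M_nonneg
  obtain ⟨-, -, h8⟩ := S.radius_ge hc1
  obtain ⟨-, -, -, h9⟩ := S.dualConst_ge
  have h10 := zero_le_one.trans h9
  refine ⟨?_, ?_, h10⟩
  · unfold countConst; positivity
  · unfold optConst; positivity

end Setting

/-! ### Summing the geometrically growing costs -/

theorem Problem.dfal_lam (P : Problem N n m) (Lγ : Fin N → ℝ) (c lam1 α1 ξ1 : ℝ)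
    (x0 : BlockVec N n) (k : ℕ) : (P.dfal Lγ c lam1 α1 ξ1 x0 k).lam = c ^ k * lam1 := by
  induction k with
  | zero => simp [Problem.dfal]
  | succ k ih =>
    change c * (P.dfal Lγ c lam1 α1 ξ1 x0 k).lam = _
    rw [ih]; ring

theorem sum_inv_pow_le {c : ℝ} (hc0 : 0 < c) (hc1 : c < 1) (j : ℕ) :
    ∑ k ∈ Finset.range (j + 1), (c ^ k)⁻¹ ≤ (c ^ j)⁻¹ / (1 - c) := by
  have h1c : 0 < 1 - c := by linarith
  induction j with
  | zero =>
    simp only [zero_add, Finset.range_one, Finset.sum_singleton, pow_zero, inv_one]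
    rw [le_div_iff₀ h1c]; linarith
  | succ j ih =>
    rw [Finset.sum_range_succ]
    refine (add_le_add_left ih _).trans (le_of_eq ?_)
    rw [pow_succ]
    field_simp
    ring

/-- If the `k`-th outer iteration costs at most `E / λ^(k)` and `Q λ^(k) ≤ ε` guarantees the
accuracy `ε`, then accuracy `ε` is reached with total cost of order `E Q / ε`. -/
theorem exists_isLeast_sum_le {c lam1 E Q q ε : ℝ} (hc0 : 0 < c) (hc1 : c < 1) (hlam1 : 0 < lam1)
    (hE : 0 ≤ E) (hQ : 1 ≤ Q) (hq : 0 ≤ q) (hε : 0 < ε) (hε1 : ε ≤ 1) {cost : ℕ → ℕ}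
    (hcost : ∀ k, (cost k : ℝ) ≤ E / (c ^ k * lam1)) {good : ℕ → Prop}
    (hgood : ∀ k, q * Q * (c ^ k * lam1) ≤ ε → good (k + 1)) :
    ∃ K, IsLeast {K | 1 ≤ K ∧ ∀ k, K ≤ k → good k} K ∧
      ((∑ k ∈ Finset.range K, cost k : ℕ) : ℝ)
        ≤ (1 / lam1 + q / c) / (1 - c) * E * Q * ε⁻¹ := by
  classical
  have h1c : 0 < 1 - c := by linarith
  have hex : ∃ j : ℕ, q * Q * (c ^ j * lam1) ≤ ε := by
    have ht : Filter.Tendsto (fun j : ℕ => q * Q * (c ^ j * lam1)) Filter.atTop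
        (nhds (q * Q * (0 * lam1))) :=
      ((tendsto_pow_atTop_nhds_zero_of_lt_one hc0.le hc1).mul_const _).const_mul _
    rw [zero_mul, mul_zero] at ht
    exact (ht.eventually (ge_mem_nhds hε)).exists
  -- State `j + 1` is produced with penalty parameter `c ^ j * lam1`, so the threshold is at most `j
  -- + 1`.
  set j := Nat.find hex with hj
  have hjspec := Nat.find_spec hex
  have hmem : j + 1 ∈ {K | 1 ≤ K ∧ ∀ k, K ≤ k → good k} := by
    refine ⟨Nat.le_add_left 1 j, fun k hk => ?_⟩
    obtain ⟨i, rfl⟩ := Nat.exists_eq_add_of_le' hk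
    refine hgood (i + j) (le_trans ?_ hjspec)
    refine mul_le_mul_of_nonneg_left (mul_le_mul_of_nonneg_right ?_ hlam1.le) (by positivity)
    exact pow_le_pow_of_le_one hc0.le hc1.le (Nat.le_add_left _ _)
  have hne : ∃ K, 1 ≤ K ∧ ∀ k, K ≤ k → good k := ⟨j + 1, hmem⟩
  refine ⟨Nat.find hne, ⟨Nat.find_spec hne, fun K hK => Nat.find_min' hne hK⟩, ?_⟩
  have hKj : Nat.find hne ≤ j + 1 := Nat.find_min' hne hmem
  have h1 : ((∑ k ∈ Finset.range (Nat.find hne), cost k : ℕ) : ℝ)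
      ≤ ∑ k ∈ Finset.range (j + 1), E / lam1 * (c ^ k)⁻¹ := by
    have : ∑ k ∈ Finset.range (Nat.find hne), cost k ≤ ∑ k ∈ Finset.range (j + 1), cost k :=
      Finset.sum_le_sum_of_subset (Finset.range_mono hKj)
    refine (Nat.cast_le.2 this).trans ?_
    push_cast
    refine Finset.sum_le_sum fun k _ => (hcost k).trans (le_of_eq ?_)
    field_simp
  rw [← Finset.mul_sum] at h1
  have h2 := h1.trans (mul_le_mul_of_nonneg_left (sum_inv_pow_le hc0 hc1 j) (by positivity))
  have h3 : (c ^ j)⁻¹ / lam1 ≤ (1 / lam1 + q / c) * Q * ε⁻¹ := by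
    have hε' : 1 ≤ ε⁻¹ := (one_le_inv₀ hε).2 hε1
    have hqQ : 0 ≤ q / c * Q * ε⁻¹ := by positivity
    have hl : 0 ≤ 1 / lam1 * Q * ε⁻¹ := by positivity
    -- For `j = 0` the bound uses `Q ≥ 1` and `ε ≤ 1`; otherwise minimality of `j` bounds `ε` from
    -- above at `j - 1`, losing a factor `c`.
    rcases Nat.eq_zero_or_pos j with h0 | h0
    · rw [h0, pow_zero, inv_one, add_mul, add_mul]
      have := le_mul_of_one_le_right (by positivity : 0 ≤ 1 / lam1)
        (one_le_mul_of_one_le_of_one_le hQ hε')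
      linarith
    · obtain ⟨i, hi⟩ := Nat.exists_eq_add_of_le' h0
      have hlt : ε < q * Q * (c ^ i * lam1) :=
        not_le.1 (Nat.find_min hex (by omega : i < j))
      have : (c ^ j)⁻¹ / lam1 ≤ q / c * Q * ε⁻¹ := by
        rw [hi, pow_succ]
        have e : (c ^ i * c)⁻¹ / lam1 = 1 / (c * (c ^ i * lam1)) := by field_simp
        have e' : q / c * Q * ε⁻¹ = q * Q / (c * ε) := by field_simp
        rw [e, e', div_le_div_iff₀ (by positivity) (by positivity)]
        nlinarith
      rw [add_mul, add_mul]
      linarith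
  have e : E / lam1 * ((c ^ j)⁻¹ / (1 - c)) = E / (1 - c) * ((c ^ j)⁻¹ / lam1) := by
    field_simp
  rw [e] at h2
  refine h2.trans ((mul_le_mul_of_nonneg_left h3 (by positivity)).trans (le_of_eq ?_))
  ring

theorem exists_pos_le {N : ℕ} {v : Fin N → ℝ} (hv : ∀ i, 0 < v i) :
    ∃ δ, 0 < δ ∧ ∀ i, δ ≤ v i := by
  rcases isEmpty_or_nonempty (Fin N) with h | h
  · exact ⟨1, one_pos, fun i => isEmptyElim i⟩
  · obtain ⟨i, hi⟩ := Finite.exists_min v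
    exact ⟨v i, hv i, hi⟩

end DFAL

end

/-! ### Assembly of the constants -/

theorem mainTheorem2
    -- what the constant `C` may depend on
    (N : ℕ) (τ B G Lγ : Fin N → ℝ) (c lam1 α1 ξ1 D s κ : ℝ)
    (hc0 : 0 < c) (hc1 : c < 1)
    (hlam1 : 0 < lam1) (hα1 : 0 < α1) (hξ1 : 0 < ξ1) (hξτ : ∀ i, ξ1 / lam1 < τ i)
    (hs : 0 < s) :
    ∃ C : ℝ, 0 < C ∧
      ∀ (n m : ℕ) (P : DFAL.Problem N n m) (low : Fin N → ℝ) (x0 : DFAL.BlockVec N n),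
        (∀ i, DFAL.IsRegularizer (P.rho i) (B i) (τ i)) →
        (∀ i, DFAL.IsSmoothTerm (P.gamma i) (Lγ i) (low i)) →
        (∀ i x, ‖gradient (P.gamma i) x‖ ≤ G i) →
        Function.Surjective P.fullA →
        (∀ i, 0 < DFAL.sigmaMin (P.A i)) →
        s ≤ DFAL.sigmaMax P.fullA →
        (n < m → P.minSigma ≤ κ * DFAL.sigmaMin P.fullA) →
        P.optVal - ∑ i, low i ≤ D →
        ‖x0‖ ≤ D →
        -- every inner call terminates
        (∀ k, (P.acceptedCounts Lγ (P.dfal Lγ c lam1 α1 ξ1 x0 k)).Nonempty) ∧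
        ∀ ε : ℝ, 0 < ε → ε ≤ 1 →
          (∃ K : ℕ,
            IsLeast {K | 1 ≤ K ∧ ∀ k, K ≤ k →
              P.EpsOptimal ε (P.dfal Lγ c lam1 α1 ξ1 x0 k).x} K ∧
            (P.totalInner Lγ c lam1 α1 ξ1 x0 K : ℝ)
              ≤ C * (P.Theta ^ 2 * DFAL.sigmaMax P.fullA * ε⁻¹)) ∧
          (∃ K : ℕ,
            IsLeast {K | 1 ≤ K ∧ ∀ k, K ≤ k →
              P.EpsFeasible ε (P.dfal Lγ c lam1 α1 ξ1 x0 k).x} K ∧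
            (P.totalInner Lγ c lam1 α1 ξ1 x0 K : ℝ)
              ≤ C * (P.Theta * DFAL.sigmaMax P.fullA * ε⁻¹)) := by

  obtain ⟨δ, hδ, hδle⟩ := DFAL.exists_pos_le fun i => sub_pos.2 (hξτ i)
  set b := ∑ i, (|B i| + |G i|) with hb
  set Λ := ∑ i, |Lγ i| with hΛ
  set M := max 1 κ with hM
  set E := DFAL.countConst N c lam1 α1 D s δ Λ with hE
  set T := DFAL.dualConst N lam1 α1 ξ1 s b M with hT
  set O := DFAL.optConst N c lam1 α1 ξ1 D s δ b M with hO
  set C₁ := (1 / lam1 + O / c) / (1 - c) * E with hC₁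
  set C₂ := (1 / lam1 + 2 * T / c) / (1 - c) * E with hC₂
  -- The constant is fixed before any problem is given; `D` might then be negative, so absolute
  -- values secure the sign.
  refine ⟨|C₁| + |C₂| + 1, by positivity, ?_⟩
  intro n m P low x0 hρ hγ hG hsurj hblk hsle hκ hgap hx0
  have hσ : 0 < DFAL.sigmaMax P.fullA := hs.trans_le hsle
  -- `σ_max(A) > 0` excludes `N = 0` and `n = 0`; two distinct points of `ℝⁿ` then force `Lγ i ≥ 0`.
  have hdim : 0 < Module.finrank ℝ (DFAL.BlockVec N n) := by
    by_contra h0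
    exact hσ.ne' (P.fullA.singularValues_of_finrank_le (not_lt.1 h0))
  have hnontriv : Nontrivial (DFAL.BlockVec N n) := Module.finrank_pos_iff.1 hdim
  have hN : Nonempty (Fin N) := by
    by_contra h
    rw [not_nonempty_iff] at h
    obtain ⟨x, y, hxy⟩ := hnontriv
    exact hxy (PiLp.ext fun i => isEmptyElim i)
  have hn : Nontrivial (DFAL.Vec n) := by
    by_contra h
    rw [not_nontrivial_iff_subsingleton] at h
    obtain ⟨x, y, hxy⟩ := hnontriv
    exact hxy (PiLp.ext fun i => Subsingleton.elim _ _)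
  have hLγ : ∀ i, 0 ≤ Lγ i := by
    intro i
    obtain ⟨x, y, hxy⟩ := hn
    have h1 := (norm_nonneg _).trans ((hγ i).lipschitz x y)
    exact nonneg_of_mul_nonneg_left h1 (norm_sub_pos_iff.2 hxy)
  have S : DFAL.Setting P B τ G Lγ low lam1 α1 ξ1 D s δ b Λ M :=
    { nonempty := hN
      lam1_pos := hlam1
      α1_pos := hα1
      ξ1_pos := hξ1
      s_pos := hs
      δ_pos := hδ
      δ_le := fun i => by linarith [hδle i]
      b_ge := fun i => (add_le_add (le_abs_self _) (le_abs_self _)).trans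
        (Finset.single_le_sum (f := fun i => |B i| + |G i|) (fun j _ => by positivity)
          (Finset.mem_univ i))
      b_nonneg := by positivity
      Λ_ge := fun i => (le_abs_self _).trans
        (Finset.single_le_sum (f := fun i => |Lγ i|) (fun j _ => by positivity)
          (Finset.mem_univ i))
      Λ_nonneg := by positivity
      Lγ_nonneg := hLγ
      M_nonneg := zero_le_one.trans (le_max_left _ _)
      D_nonneg := (norm_nonneg _).trans hx0
      rho := hρ
      gamma := hγ
      grad := hG
      surj := hsurj
      minSigma_pos := DFAL.Problem.minSigma_pos hblk
      s_le := hsle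
      preimage := DFAL.Problem.exists_preimage_minSigma_le hblk hsurj hκ
        (le_max_left _ _) (le_max_right _ _)
      gap := hgap }
  have hctl := S.controlled_dfal hc0 hc1 hx0
  obtain ⟨hE0, hO0, hT0⟩ := S.constants_nonneg hc1
  have hΘ := S.one_le_Theta
  have hcost : ∀ k, (P.innerCount Lγ (P.dfal Lγ c lam1 α1 ξ1 x0 k) : ℝ)
      ≤ E * DFAL.sigmaMax P.fullA / (c ^ k * lam1) := by
    intro k
    rw [← P.dfal_lam Lγ c lam1 α1 ξ1 x0 k]
    exact (S.count_le hc1 (hctl k)).2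
  have habsorb : ∀ C' X : ℝ, C' ≤ |C₁| + |C₂| → 0 ≤ X → C' * X ≤ (|C₁| + |C₂| + 1) * X :=
    fun C' X h hX => mul_le_mul_of_nonneg_right (by linarith) hX
  refine ⟨fun k => (S.count_le hc1 (hctl k)).1, fun ε hε hε1 => ⟨?_, ?_⟩⟩
  · obtain ⟨K, hK, hsum⟩ := DFAL.exists_isLeast_sum_le hc0 hc1 hlam1 (mul_nonneg hE0 hσ.le)
      (one_le_pow₀ hΘ : 1 ≤ P.Theta ^ 2) hO0 hε hε1 hcost
      (good := fun k => P.EpsOptimal ε (P.dfal Lγ c lam1 α1 ξ1 x0 k).x) fun k hk => by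
        rw [← P.dfal_lam Lγ c lam1 α1 ξ1 x0 k] at hk
        exact (S.step hc0 hc1 (hctl k)).2.2.trans hk
    refine ⟨K, hK, hsum.trans (le_trans (le_of_eq ?_) (habsorb C₁ _ ?_ ?_))⟩
    · rw [hC₁]; ring
    · linarith [le_abs_self C₁, abs_nonneg C₂]
    · positivity
  · obtain ⟨K, hK, hsum⟩ := DFAL.exists_isLeast_sum_le hc0 hc1 hlam1 (mul_nonneg hE0 hσ.le)
      hΘ (mul_nonneg zero_le_two hT0) hε hε1 hcost
      (good := fun k => P.EpsFeasible ε (P.dfal Lγ c lam1 α1 ξ1 x0 k).x) fun k hk => by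
        rw [← P.dfal_lam Lγ c lam1 α1 ξ1 x0 k] at hk
        exact (S.step hc0 hc1 (hctl k)).2.1.trans hk
    refine ⟨K, hK, hsum.trans (le_trans (le_of_eq ?_) (habsorb C₂ _ ?_ ?_))⟩
    · rw [hC₂]; ring
    · linarith [le_abs_self C₂, abs_nonneg C₁]
    · have := zero_le_one.trans hΘ
      positivity
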